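/- Let $S_1,S_2$ be Riemann surfaces with conformal Riemannian metrics $\sigma|dz|^2$ and $\rho|dw|^2$ ($\sigma,\rho$ smooth and positive in conformal charts), and let $\mu$ be a Beltrami differential on $S_1$: a measurable function $\mu=\mu(z)$ in every conformal chart $z$ of $S_1$, with $\mu(z)\,\overline{dz}/dz$ independent of the chart, and $\|\mu\|_\infty<1$. Write $\mu=r+i\tau$ ($r,\tau$ real) and $$A=\begin{pmatrix}\alpha_1&\alpha_2\\ \alpha_2&\alpha_3\end{pmatrix},\quad \alpha_1=\frac{(r-1)^2+\tau^2}{1-r^2-\tau^2},\quad \alpha_2=-\frac{2\tau}{1-r^2-\tau^2},\quad \alpha_3=\frac{(1+r)^2+\tau^2}{1-r^2-\tau^2}.$$ The Beltrami PDE (generalized Laplace equation) for $h=u+iv$ is $$\nabla\cdot(A\nabla u)=0,\qquad \nabla\cdot(A\nabla v)=0. \qquad (*)$$ Let $g$ be the metric $|dz+\mu\,d\bar z|^2$ on $S_1$. It is determined up to a positive conformal factor, which affects none of the notions below; as a globally defined metric take $g=\sigma|dz+\mu\,d\bar z|^2$. Maps are continuous, gradients are weak gradients that are locally square integrable in charts,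 and divergence-form equations are understood in the weak sense, in every conformal chart of $S_1$. A map $h:S_1\to S_2$ is said to solve $(*)$, the Laplace equation $\Delta_g h=0$, or the Beltrami equation $h_{\bar z}=\mu h_z$, if its expression $w\circ h=u+iv$ does so in every local conformal coordinate $w$ of $S_2$. A function $f:S_1\to\mathbb C$ is said to solve $(*)$ or $\Delta_g f=0$ if its real and imaginary parts do. A harmonic map is a critical point of the Dirichlet energy $\int|\nabla h|^2\,dv$ of the given metrics with respect to smooth compactly supported variations $h+t\eta$ in local conformal coordinates. **Theorem.** 1. For every $h:S_1\to S_2$: $h$ solves the Beltrami equation $h_{\bar z}=\mu h_z$ if and only if $h$ solves $(*)$ and the Jacobian of $h$ is nonnegative almost everywhere. (So, among orientation-preserving maps, the solutions of $(*)$ are the maps with Beltrami coefficient $\mu$; in particular every quasi-conformal map associated with $\mu$ solves $(*)$.) 2. Every $h:S_1\to S_2$ that solves $(*)$ is a harmonic map from $(S_1,|dz+\mu\,d\bar z|^2)$ to $(S_2,\rho|dw|^2)$. In particular so is every quasi-conformal map associated with $\mu$. 3. Solving the Laplace equation under the distorted metric is equivalent to solving the Beltrami PDE: a map $h:S_1\to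 S_2$ solves $\Delta_g h=0$ if and only if it solves $(*)$. Likewise, for every $f:S_1\to\mathbb C$ the following are equivalent: $\Delta_g f=0$; $f$ solves $(*)$; $f$ is a harmonic map from $(S_1,|dz+\mu\,d\bar z|^2)$ to $(\mathbb C,|dw|^2)$. -/

import Mathlib

open scoped Manifold ContDiff ComplexConjugate
open MeasureTheory

noncomputable section

namespace QCHarmonic

/-! ### Weak gradients on open sets of the plane -/

/-- `η` is a smooth test function with compact support in `Ω`. -/
structure IsTest {F : Type*} [NormedAddCommGroup F] [NormedSpace ℝ F]
    (Ω : Set ℂ) (η : ℂ → F) : Prop where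
  smooth : ContDiff ℝ ∞ η
  compact : HasCompactSupport η
  support : tsupport η ⊆ Ω

/-- The partial derivative in the direction of `x`, where `z = x + i y`. -/
def dx {F : Type*} [NormedAddCommGroup F] [NormedSpace ℝ F] (η : ℂ → F) (z : ℂ) : F :=
  fderiv ℝ η z 1

/-- The partial derivative in the direction of `y`, where `z = x + i y`. -/
def dy {F : Type*} [NormedAddCommGroup F] [NormedSpace ℝ F] (η : ℂ → F) (z : ℂ) : F :=
  fderiv ℝ η z Complex.I

/-- `f` belongs to `W^{1,2}_loc(Ω)`, with weak partial derivatives `f_x = p` and `f_y = q`. -/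
structure HasWeakGradient (Ω : Set ℂ) (f p q : ℂ → ℂ) : Prop where
  memLp : ∀ K : Set ℂ, IsCompact K → K ⊆ Ω → MemLp f 2 (volume.restrict K)
  memLp_x : ∀ K : Set ℂ, IsCompact K → K ⊆ Ω → MemLp p 2 (volume.restrict K)
  memLp_y : ∀ K : Set ℂ, IsCompact K → K ⊆ Ω → MemLp q 2 (volume.restrict K)
  weak_x : ∀ η : ℂ → ℝ, IsTest Ω η → ∫ z, dx η z • f z = -∫ z, η z • p z
  weak_y : ∀ η : ℂ → ℝ, IsTest Ω η → ∫ z, dy η z • f z = -∫ z, η z • q z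

/-! ### Riemann surfaces: charts, conformal metrics, Beltrami differentials -/

/-- The conformal charts of a Riemann surface: the maximal holomorphic atlas. -/
abbrev Charts (S : Type*) [TopologicalSpace S] [ChartedSpace ℂ S] :
    Set (OpenPartialHomeomorph S ℂ) :=
  IsManifold.maximalAtlas 𝓘(ℂ) ω S

/-- A conformal Riemannian metric on a Riemann surface, `density φ z * |dz|²` in the chart `φ`. -/
structure ConformalMetric (S : Type*) [TopologicalSpace S] [ChartedSpace ℂ S] where
  density : OpenPartialHomeomorph S ℂ → ℂ → ℝ
  smooth : ∀ φ ∈ Charts S, ContDiffOn ℝ ∞ (density φ) φ.target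
  pos : ∀ φ ∈ Charts S, ∀ z ∈ φ.target, 0 < density φ z
  transform : ∀ φ ∈ Charts S, ∀ ψ ∈ Charts S, ∀ z ∈ (φ.symm.trans ψ).source,
    density φ z = density ψ (ψ (φ.symm z)) * ‖deriv (ψ ∘ φ.symm) z‖ ^ 2

/-- A Beltrami differential `μ(z) dz̄/dz` on a Riemann surface: a measurable function in every
chart, transforming as a `(-1,1)`-differential, with `‖μ‖_∞ < 1`. -/
structure BeltramiDifferential (S : Type*) [TopologicalSpace S] [ChartedSpace ℂ S] where
  coeff : OpenPartialHomeomorph S ℂ → ℂ → ℂ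
  measurable : ∀ φ ∈ Charts S, AEStronglyMeasurable (coeff φ) (volume.restrict φ.target)
  bound : ∃ k : ℝ, k < 1 ∧ ∀ φ ∈ Charts S, ∀ᵐ z ∂(volume.restrict φ.target), ‖coeff φ z‖ ≤ k
  transform : ∀ φ ∈ Charts S, ∀ ψ ∈ Charts S,
    ∀ᵐ z ∂(volume.restrict (φ.symm.trans ψ).source),
      coeff φ z = coeff ψ (ψ (φ.symm z)) *
        (conj (deriv (ψ ∘ φ.symm) z) / deriv (ψ ∘ φ.symm) z)

lemma differentiableAt_symm {φ : OpenPartialHomeomorph ℂ ℂ} (hφ : φ ∈ Charts ℂ)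
    {z : ℂ} (hz : z ∈ φ.target) : DifferentiableAt ℂ φ.symm z := by
  have h := (contMDiffOn_symm_of_mem_maximalAtlas hφ).contDiffOn
  exact (h.contDiffAt (φ.open_target.mem_nhds hz)).differentiableAt (by simp)

lemma differentiableAt_chart {φ : OpenPartialHomeomorph ℂ ℂ} (hφ : φ ∈ Charts ℂ)
    {z : ℂ} (hz : z ∈ φ.source) : DifferentiableAt ℂ φ z := by
  have h := (contMDiffOn_of_mem_maximalAtlas hφ).contDiffOn
  exact (h.contDiffAt (φ.open_source.mem_nhds hz)).differentiableAt (by simp)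

lemma deriv_symm_ne_zero {φ : OpenPartialHomeomorph ℂ ℂ} (hφ : φ ∈ Charts ℂ)
    {z : ℂ} (hz : z ∈ φ.target) : deriv φ.symm z ≠ 0 := by
  intro h0
  have h1 : HasDerivAt (φ ∘ φ.symm) (deriv φ (φ.symm z) * deriv φ.symm z) z :=
    (differentiableAt_chart hφ (φ.map_target hz)).hasDerivAt.comp z
      (differentiableAt_symm hφ hz).hasDerivAt
  have h2 : HasDerivAt (φ ∘ φ.symm) 1 z := by
    refine (hasDerivAt_id z).congr_of_eventuallyEq ?_
    filter_upwards [φ.open_target.mem_nhds hz] with w hw using φ.right_inv hw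
  have h3 := h1.unique h2
  simp [h0] at h3

/-- The metric `|dw|²` on the complex plane, with its expression in every conformal chart. -/
def flatMetric : ConformalMetric ℂ where
  density φ z := ‖deriv φ.symm z‖ ^ 2
  smooth φ hφ := by
    have h : ContDiffOn ℂ ω φ.symm φ.target :=
      (contMDiffOn_symm_of_mem_maximalAtlas hφ).contDiffOn
    have h1 : ContDiffOn ℂ ∞ (deriv φ.symm) φ.target :=
      h.deriv_of_isOpen φ.open_target (by simp)
    exact (h1.restrict_scalars ℝ).norm_sq ℝ
  pos φ hφ z hz := by
    have := deriv_symm_ne_zero hφ hz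
    positivity
  transform φ hφ ψ hψ z hz := by
    have hz1 : z ∈ φ.target := hz.1
    have hz2 : φ.symm z ∈ ψ.source := hz.2
    have h1 : HasDerivAt (ψ ∘ φ.symm) (deriv (ψ ∘ φ.symm) z) z :=
      ((differentiableAt_chart hψ hz2).comp z (differentiableAt_symm hφ hz1)).hasDerivAt
    have h2 : HasDerivAt (ψ.symm ∘ (ψ ∘ φ.symm))
        (deriv ψ.symm (ψ (φ.symm z)) * deriv (ψ ∘ φ.symm) z) z :=
      (differentiableAt_symm hψ (ψ.map_source hz2)).hasDerivAt.comp z h1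
    have h3 : HasDerivAt φ.symm
        (deriv ψ.symm (ψ (φ.symm z)) * deriv (ψ ∘ φ.symm) z) z := by
      refine h2.congr_of_eventuallyEq ?_
      filter_upwards [(φ.symm.trans ψ).open_source.mem_nhds hz] with w hw
      exact (ψ.left_inv hw.2).symm
    rw [h3.deriv, norm_mul, mul_pow]

/-! ### Local expressions of a map -/

section Maps

variable {S T : Type*} [TopologicalSpace S] [ChartedSpace ℂ S]
  [TopologicalSpace T] [ChartedSpace ℂ T]

/-- The domain `φ(U ∩ h⁻¹(V))` of the local expression of `h` in charts `(U, φ)`, `(V, ψ)`. -/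
def locDomain (h : S → T) (φ : OpenPartialHomeomorph S ℂ) (ψ : OpenPartialHomeomorph T ℂ) :
    Set ℂ :=
  φ.target ∩ φ.symm ⁻¹' (h ⁻¹' ψ.source)

/-- The local expression `ψ ∘ h ∘ φ⁻¹` of `h`. -/
def loc (h : S → T) (φ : OpenPartialHomeomorph S ℂ) (ψ : OpenPartialHomeomorph T ℂ) : ℂ → ℂ :=
  fun z => ψ (h (φ.symm z))

/-! ### The Beltrami equation and the generalized Laplace equation -/

/-- `h` is a weak (`W^{1,2}_loc`) solution of `h_z̄ = μ h_z` in all conformal charts, where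
`h_z = (h_x - i h_y) / 2` and `h_z̄ = (h_x + i h_y) / 2`. -/
def SolvesBeltrami (μ : BeltramiDifferential S) (h : S → T) : Prop :=
  ∀ φ ∈ Charts S, ∀ ψ ∈ Charts T, ∃ p q : ℂ → ℂ,
    HasWeakGradient (locDomain h φ ψ) (loc h φ ψ) p q ∧
    ∀ᵐ z ∂(volume.restrict (locDomain h φ ψ)),
      (p z + Complex.I * q z) / 2 = μ.coeff φ z * ((p z - Complex.I * q z) / 2)

/-- The Jacobian determinant `u_x v_y - u_y v_x` of `h = u + i v` is nonnegative almost
everywhere, in all conformal charts. -/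
def JacobianNonneg (h : S → T) : Prop :=
  ∀ φ ∈ Charts S, ∀ ψ ∈ Charts T, ∃ p q : ℂ → ℂ,
    HasWeakGradient (locDomain h φ ψ) (loc h φ ψ) p q ∧
    ∀ᵐ z ∂(volume.restrict (locDomain h φ ψ)),
      0 ≤ (p z).re * (q z).im - (q z).re * (p z).im

/-- The coefficient matrix of the generalized Laplace equation, with `m = ρ + i τ`. -/
def coeffMatrix (m : ℂ) : Matrix (Fin 2) (Fin 2) ℝ :=
  !![((m.re - 1) ^ 2 + m.im ^ 2) / (1 - m.re ^ 2 - m.im ^ 2),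
      -(2 * m.im) / (1 - m.re ^ 2 - m.im ^ 2);
    -(2 * m.im) / (1 - m.re ^ 2 - m.im ^ 2),
      ((1 + m.re) ^ 2 + m.im ^ 2) / (1 - m.re ^ 2 - m.im ^ 2)]

open Matrix in
/-- `∇·(M ∇u) = 0` and `∇·(M ∇v) = 0` on `Ω` in the weak sense, where `p = u_x + i v_x` and
`q = u_y + i v_y`. -/
def WeakDivFree (Ω : Set ℂ) (M : ℂ → Matrix (Fin 2) (Fin 2) ℝ) (p q : ℂ → ℂ) : Prop :=
  ∀ η : ℂ → ℝ, IsTest Ω η →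
    ∫ z, ![dx η z, dy η z] ⬝ᵥ (M z *ᵥ ![(p z).re, (q z).re]) = 0 ∧
    ∫ z, ![dx η z, dy η z] ⬝ᵥ (M z *ᵥ ![(p z).im, (q z).im]) = 0

/-- The coordinate expression `u + i v = ψ ∘ h` in the target chart `ψ` is a weak solution of
the generalized Laplace equation `∇·(A ∇u) = ∇·(A ∇v) = 0`. -/
def SolvesGenLaplaceIn (μ : BeltramiDifferential S) (h : S → T)
    (ψ : OpenPartialHomeomorph T ℂ) : Prop :=
  ∀ φ ∈ Charts S, ∃ p q : ℂ → ℂ,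
    HasWeakGradient (locDomain h φ ψ) (loc h φ ψ) p q ∧
    WeakDivFree (locDomain h φ ψ) (fun z => coeffMatrix (μ.coeff φ z)) p q

/-- `h` solves the generalized Laplace equation, in every conformal coordinate of the target. -/
def SolvesGenLaplace (μ : BeltramiDifferential S) (h : S → T) : Prop :=
  ∀ ψ ∈ Charts T, SolvesGenLaplaceIn μ h ψ

/-! ### The distorted metric, its Laplace equation, harmonic maps -/

/-- The matrix `(g_ij)`, in the basis `∂_x, ∂_y`, of the metric `s |dz + m dz̄|²`. -/
def distortedMatrix (s : ℝ) (m : ℂ) : Matrix (Fin 2) (Fin 2) ℝ :=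
  let e : Fin 2 → ℂ := ![1, Complex.I]
  let θ : ℂ → ℂ := fun v => v + m * conj v
  Matrix.of fun i j => s * (θ (e i) * conj (θ (e j))).re

/-- The metric `σ |dz + μ dz̄|²` in the chart `φ`.  (The factor `σ` makes the expressions in
different charts agree; `|dz + μ dz̄|²` alone is determined up to a conformal factor.) -/
def distorted (σ : ConformalMetric S) (μ : BeltramiDifferential S)
    (φ : OpenPartialHomeomorph S ℂ) (z : ℂ) : Matrix (Fin 2) (Fin 2) ℝ :=
  distortedMatrix (σ.density φ z) (μ.coeff φ z)

/-- The coordinate expression `ψ ∘ h` in the target chart `ψ` is a weak solution of the Laplace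
equation `Δ_g (ψ ∘ h) = 0`, `Δ_g u = (det g)^{-1/2} ∂_i ((det g)^{1/2} g^{ij} ∂_j u)`, for the
metric `g = σ |dz + μ dz̄|²`. -/
def SolvesLaplaceIn (σ : ConformalMetric S) (μ : BeltramiDifferential S) (h : S → T)
    (ψ : OpenPartialHomeomorph T ℂ) : Prop :=
  ∀ φ ∈ Charts S, ∃ p q : ℂ → ℂ,
    HasWeakGradient (locDomain h φ ψ) (loc h φ ψ) p q ∧
    WeakDivFree (locDomain h φ ψ)
      (fun z => Real.sqrt (distorted σ μ φ z).det • (distorted σ μ φ z)⁻¹) p q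

/-- `h` solves the Laplace equation of the metric `σ |dz + μ dz̄|²`, in every conformal
coordinate of the target. -/
def SolvesLaplace (σ : ConformalMetric S) (μ : BeltramiDifferential S) (h : S → T) : Prop :=
  ∀ ψ ∈ Charts T, SolvesLaplaceIn σ μ h ψ

/-- The Dirichlet energy density `|df|² dv_g / (dx dy) = r g^{ij} ⟨f_i, f_j⟩ (det g)^{1/2}` of a
map with partial derivatives `f_x = p`, `f_y = q`, for the metric `g` on the source and
`r |dw|²` on the target. -/
def energyDensity (g : Matrix (Fin 2) (Fin 2) ℝ) (r : ℝ) (p q : ℂ) : ℝ :=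
  let d : Fin 2 → ℂ := ![p, q]
  (∑ i, ∑ j, g⁻¹ i j * (r * (d i * conj (d j)).re)) * Real.sqrt g.det

/-- `h` is a harmonic map from `(S, σ |dz + μ dz̄|²)` to `(T, ρ |dw|²)`: it is of class
`W^{1,2}_loc` and a critical point of the Dirichlet energy.  The variations are
`h_t = h + t η` in local coordinates, with `η` smooth of compact support; outside of the compact
set `K` the map is not changed, so the energy over `K` carries the whole variation. -/
def IsHarmonic (σ : ConformalMetric S) (μ : BeltramiDifferential S) (ρ : ConformalMetric T)
    (h : S → T) : Prop :=
  ∀ φ ∈ Charts S, ∀ ψ ∈ Charts T, ∃ p q : ℂ → ℂ,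
    HasWeakGradient (locDomain h φ ψ) (loc h φ ψ) p q ∧
    ∀ K : Set ℂ, IsCompact K → K ⊆ locDomain h φ ψ →
      ∀ η : ℂ → ℂ, IsTest (locDomain h φ ψ) η → tsupport η ⊆ K →
        HasDerivAt (fun t : ℝ => ∫ z in K,
          energyDensity (distorted σ μ φ z) (ρ.density ψ (loc h φ ψ z + t * η z))
            (p z + t * dx η z) (q z + t * dy η z)) 0 0

end Maps

end QCHarmonic

end

/-!
Write `A ∇h = (P, Q)` for the complex flux of `h = u + i v` (`fluxX`, `fluxY`), so that the
generalized Laplace equation says that the field `(P, Q)` is weakly divergence-free.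

The analytic core is `IsDivFree.integral_comp_mul_eq_zero`: a divergence-free `L²_loc` field may be
tested not only against smooth `η`, but also against `Φ(f) η` with `Φ` smooth and `f` a continuous
`W^{1,2}_loc` function. It is proved by mollifying `f`: the mollifications converge pointwise and
their gradients converge in `L²`. Its case of constant fields is the chain rule for weak gradients.

*Conformality.* Let `h` solve the equation in every conformal coordinate of the target, in
particular in a coordinate `w` and in `F(w) = 1 / (w - c)`. As `∇F(h) = F'(h) ∇h`, testing
`A ∇h` against `F'(h) η` and comparing with the equation for `F(h)` leaves
`∫ η F''(h) (A ∇h · ∇h) = 0` with the complex bilinear product, hence `A ∇h · ∇h = 0` almost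
everywhere (`SolvesGenLaplace.ae_mul_flux_eq_zero`). This quadratic form factors as a nonzero
multiple of `(h_z̄ - μ h_z) (h_z - μ̄ h_z̄)` (`mul_fluxX_add_mul_fluxY`), so that a nonnegative
Jacobian `|h_z|² - |h_z̄|²` leaves the Beltrami equation. Conversely, the Beltrami equation means
`A ∇u = (v_y, -v_x)`, `A ∇v = (-u_y, u_x)`, and these fields are divergence-free because mixed
second derivatives commute.

*Laplace equation.* For `g = σ |dz + μ dz̄|²` one computes `(det g)^{1/2} g⁻¹ = A`
(`sqrt_det_smul_inv_distortedMatrix`).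

*Harmonicity.* By the same computation the energy density is `ρ(h) Re (A ∇h · ∇h̄)`, and the first
variation is `∫ Dρ(h)[η] (A ∇h · ∇h̄) + 2 ρ(h) Re (A ∇h · ∇η̄)` (`hasDerivAt_energy`). If
`A ∇h · ∇h = 0`, this is `2 Re ∫ A ∇h · ∇(ρ(h) η̄) = 0`. For a map `f` into the flat plane, written
in a coordinate as `f = G(h)`, it is `2 Re ∫ A ∇f · ∇(conj (G'(h) η)) = 0`; in the standard
coordinate it is `2 Re ∫ A ∇f · ∇η̄`, whose vanishing for all `η` is the equation for `f`.
-/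

noncomputable section

namespace QCHarmonic

open Filter Topology Metric ContinuousLinearMap
open scoped ENNReal Convolution

/-! ### Mollification in `L²` -/

lemma tendsto_eLpNorm_translate_sub {p : ℂ → ℂ} (hp : MemLp p 2 volume) :
    Tendsto (fun y : ℂ => eLpNorm (fun x => p (x - y) - p x) 2 volume) (𝓝 0) (𝓝 0) := by
  have : Fact ((2 : ℝ≥0∞) ≠ ⊤) := ⟨by simp⟩
  have hc : Continuous fun y : ℂ => (DomAddAct.mk (-y) +ᵥ hp.toLp p : Lp ℂ 2 volume) := by
    have : Continuous fun y : ℂ => DomAddAct.mk (-y) :=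
      DomAddAct.continuous_mk.comp continuous_neg
    exact this.vadd continuous_const
  have h0 := (hc.sub (continuous_const (y := hp.toLp p))).norm.tendsto 0
  have h1 : Tendsto (fun y : ℂ => ENNReal.ofReal
      ‖(DomAddAct.mk (-y) +ᵥ hp.toLp p : Lp ℂ 2 volume) - hp.toLp p‖) (𝓝 0) (𝓝 0) := by
    have h2 := (ENNReal.continuous_ofReal.tendsto _).comp h0
    simpa [Function.comp_def] using h2
  refine h1.congr fun y => ?_
  rw [ofReal_norm, Lp.enorm_def]
  refine eLpNorm_congr_ae ?_
  have hq : MeasurePreserving (fun x : ℂ => x - y) volume volume :=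
    measurePreserving_sub_right volume y
  filter_upwards [Lp.coeFn_sub (DomAddAct.mk (-y) +ᵥ hp.toLp p : Lp ℂ 2 volume) (hp.toLp p),
    DomAddAct.vadd_Lp_ae_eq (DomAddAct.mk (-y)) (hp.toLp p), hp.coeFn_toLp,
    hq.quasiMeasurePreserving.ae hp.coeFn_toLp] with x h1 h2 h3 h4
  rw [h1, Pi.sub_apply, h2, h3]
  congr 1
  rw [← h4]
  simp [sub_eq_neg_add]

/-- A mollification is an average of translates, so it is no farther from `p` in `L²` than the
worst of them: Jensen's inequality in the averaging variable, then Tonelli. -/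
lemma eLpNorm_mollify_sub_le (φ : ContDiffBump (0 : ℂ)) {p : ℂ → ℂ} (hp : MemLp p 2 volume)
    {C : ℝ≥0∞} (h : ∀ y ∈ ball (0 : ℂ) φ.rOut, eLpNorm (fun x => p (x - y) - p x) 2 volume ≤ C) :
    eLpNorm (fun x => (φ.normed volume ⋆[lsmul ℝ ℝ, volume] p) x - p x) 2 volume ≤ C := by
  wlog hm : StronglyMeasurable p generalizing p
  · obtain ⟨p', hp', he⟩ := hp.1
    rw [convolution_congr (lsmul ℝ ℝ) (Filter.EventuallyEq.refl _ _) he]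
    refine (eLpNorm_congr_ae ?_).trans_le (this ((memLp_congr_ae he).1 hp) (fun y hy => ?_) hp')
    · filter_upwards [he] with x hx
      rw [hx]
    · refine (eLpNorm_congr_ae ?_).trans_le (h y hy)
      have hq : MeasurePreserving (fun x : ℂ => x - y) volume volume :=
        measurePreserving_sub_right volume y
      filter_upwards [he, hq.quasiMeasurePreserving.ae he] with x h1 h2
      rw [h1, h2]
  set w : ℂ → ℝ≥0∞ := fun y => ENNReal.ofReal (φ.normed volume y) with hw
  have hwm : Measurable w := (φ.continuous_normed.measurable).ennreal_ofReal
  set ν : Measure ℂ := volume.withDensity w with hν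
  have hprob : IsProbabilityMeasure ν := by
    refine ⟨?_⟩
    rw [hν, withDensity_apply _ MeasurableSet.univ, Measure.restrict_univ,
      ← ofReal_integral_eq_lintegral_ofReal φ.integrable_normed
        (Eventually.of_forall φ.nonneg_normed), φ.integral_normed, ENNReal.ofReal_one]
  have hloc : LocallyIntegrable p volume := hp.locallyIntegrable (by norm_num)
  have hsm : StronglyMeasurable (Function.uncurry fun x y : ℂ => p (x - y) - p x) :=
    (hm.comp_measurable (measurable_fst.sub measurable_snd)).sub
      (hm.comp_measurable measurable_fst)
  have hpt : ∀ x, ‖(φ.normed volume ⋆[lsmul ℝ ℝ, volume] p) x - p x‖ₑ ^ (2 : ℝ) ≤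
      ∫⁻ y, ‖p (x - y) - p x‖ₑ ^ (2 : ℝ) ∂ν := by
    intro x
    have hsx : StronglyMeasurable fun y : ℂ => p (x - y) - p x :=
      hsm.comp_measurable measurable_prodMk_left
    have hi : Integrable (fun y => φ.normed volume y • p (x - y)) := by
      have := φ.hasCompactSupport_normed (μ := volume) |>.convolutionExists_left (lsmul ℝ ℝ)
        φ.continuous_normed hloc x
      exact this
    have e1 : (φ.normed volume ⋆[lsmul ℝ ℝ, volume] p) x - p x =
        ∫ y, φ.normed volume y • (p (x - y) - p x) := by
      simp_rw [smul_sub]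
      rw [integral_sub hi (φ.integrable_normed.smul_const _), integral_smul_const,
        φ.integral_normed, one_smul]
      rfl
    have e2 : ‖(φ.normed volume ⋆[lsmul ℝ ℝ, volume] p) x - p x‖ₑ ≤
        eLpNorm (fun y => p (x - y) - p x) 1 ν := by
      rw [e1, eLpNorm_one_eq_lintegral_enorm, hν,
        lintegral_withDensity_eq_lintegral_mul _ hwm hsx.enorm]
      refine (enorm_integral_le_lintegral_enorm _).trans (lintegral_mono fun y => ?_)
      rw [enorm_smul, Real.enorm_of_nonneg (φ.nonneg_normed y)]
      rfl
    have e3 := e2.trans (eLpNorm_le_eLpNorm_of_exponent_le (p := 1) (q := 2) (by norm_num)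
      hsx.aestronglyMeasurable)
    have e4 := ENNReal.rpow_le_rpow (z := 2) e3 (by norm_num)
    rwa [eLpNorm_eq_lintegral_rpow_enorm_toReal (by norm_num) (by norm_num), ← ENNReal.rpow_mul,
      ENNReal.toReal_ofNat, show (1 / 2 * 2 : ℝ) = 1 by norm_num, ENNReal.rpow_one] at e4
  have hb : ∀ᵐ y ∂ν, ∫⁻ x, ‖p (x - y) - p x‖ₑ ^ (2 : ℝ) ≤ C ^ (2 : ℝ) := by
    rw [hν, ae_withDensity_iff hwm]
    refine Eventually.of_forall fun y hy => ?_
    have hy' : y ∈ ball (0 : ℂ) φ.rOut := by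
      rw [← φ.support_normed_eq (μ := volume)]
      intro h0
      exact hy (by simp [hw, h0])
    have e4 := ENNReal.rpow_le_rpow (z := 2) (h y hy') (by norm_num)
    rwa [eLpNorm_eq_lintegral_rpow_enorm_toReal (by norm_num) (by norm_num), ← ENNReal.rpow_mul,
      ENNReal.toReal_ofNat, show (1 / 2 * 2 : ℝ) = 1 by norm_num, ENNReal.rpow_one] at e4
  rw [eLpNorm_eq_lintegral_rpow_enorm_toReal (by norm_num) (by norm_num), ENNReal.toReal_ofNat]
  have key : ∫⁻ x, ‖(φ.normed volume ⋆[lsmul ℝ ℝ, volume] p) x - p x‖ₑ ^ (2 : ℝ) ≤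
      C ^ (2 : ℝ) := by
    calc _ ≤ ∫⁻ x, ∫⁻ y, ‖p (x - y) - p x‖ₑ ^ (2 : ℝ) ∂ν := lintegral_mono hpt
      _ = ∫⁻ y, (∫⁻ x, ‖p (x - y) - p x‖ₑ ^ (2 : ℝ)) ∂ν := by
        rw [lintegral_lintegral_swap]
        exact (hsm.enorm.pow_const _).aemeasurable
      _ ≤ ∫⁻ y, C ^ (2 : ℝ) ∂ν := lintegral_mono_ae hb
      _ = C ^ (2 : ℝ) := by simp
  calc _ ≤ (C ^ (2 : ℝ)) ^ (1 / 2 : ℝ) := ENNReal.rpow_le_rpow key (by norm_num)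
    _ = C := by rw [← ENNReal.rpow_mul]; norm_num

lemma tendsto_eLpNorm_mollify_sub {φ : ℕ → ContDiffBump (0 : ℂ)}
    (hφ : Tendsto (fun n => (φ n).rOut) atTop (𝓝 0)) {p : ℂ → ℂ} (hp : MemLp p 2 volume) :
    Tendsto (fun n => eLpNorm
      (fun x => ((φ n).normed volume ⋆[lsmul ℝ ℝ, volume] p) x - p x) 2 volume)
      atTop (𝓝 0) := by
  rw [ENNReal.tendsto_nhds_zero]
  intro ε hε
  have h1 := (ENNReal.tendsto_nhds_zero.1 (tendsto_eLpNorm_translate_sub hp)) ε hε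
  obtain ⟨δ, hδ, hb⟩ := Metric.eventually_nhds_iff_ball.1 h1
  filter_upwards [hφ.eventually (gt_mem_nhds hδ)] with n hn
  exact eLpNorm_mollify_sub_le (φ n) hp fun y hy => hb y (ball_subset_ball hn.le hy)

/-! ### Cutoffs, test functions and smooth approximation -/

section Cutoff

variable {F : Type*} [NormedAddCommGroup F] [NormedSpace ℝ F]

lemma exists_contDiff_eventuallyEq_of_isCompact {Φ : ℂ → F} {V L : Set ℂ} (hV : IsOpen V)
    (hΦ : ContDiffOn ℝ ∞ Φ V) (hL : IsCompact L) (hLV : L ⊆ V) :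
    ∃ Ψ : ℂ → F, ContDiff ℝ ∞ Ψ ∧ HasCompactSupport Ψ ∧ ∀ w ∈ L, Ψ =ᶠ[𝓝 w] Φ := by
  obtain ⟨t, ht, hLt, htV⟩ := exists_compact_between hL hV hLV
  obtain ⟨χ, h1, h0, -⟩ := exists_contMDiffMap_one_nhds_of_subset_interior 𝓘(ℝ, ℂ) (n := ⊤)
    hL.isClosed hLt
  have hχ : ContDiff ℝ ∞ χ := χ.contMDiff.contDiff
  refine ⟨fun w => χ w • Φ w, ?_, ?_, ?_⟩
  · rw [contDiff_iff_contDiffAt]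
    intro w
    by_cases hw : w ∈ V
    · exact hχ.contDiffAt.smul (hΦ.contDiffAt (hV.mem_nhds hw))
    · have hwt : w ∈ tᶜ := fun h => hw (htV h)
      refine (contDiffAt_const (c := (0 : F))).congr_of_eventuallyEq ?_
      filter_upwards [ht.isClosed.isOpen_compl.mem_nhds hwt] with x hx
      simp [h0 x hx]
  · exact HasCompactSupport.intro ht fun x hx => by simp [h0 x hx]
  · intro w hw
    filter_upwards [(eventually_nhdsSet_iff_forall.1 h1) w hw] with x hx
    simp [hx]

end Cutoff

section Test

variable {F : Type*} [NormedAddCommGroup F] [NormedSpace ℝ F] {Ω : Set ℂ} {η : ℂ → F}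

lemma IsTest.isCompact (h : IsTest Ω η) : IsCompact (tsupport η) := h.compact

lemma IsTest.mono {Ω' : Set ℂ} (h : IsTest Ω η) (hs : Ω ⊆ Ω') : IsTest Ω' η :=
  ⟨h.smooth, h.compact, h.support.trans hs⟩

lemma fderiv_eq_zero_of_notMem_tsupport {z : ℂ} (hz : z ∉ tsupport η) : fderiv ℝ η z = 0 := by
  by_contra h
  exact hz (support_fderiv_subset ℝ h)

lemma dx_of_notMem_tsupport {z : ℂ} (hz : z ∉ tsupport η) : dx η z = 0 := by
  simp [dx, fderiv_eq_zero_of_notMem_tsupport hz]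

lemma dy_of_notMem_tsupport {z : ℂ} (hz : z ∉ tsupport η) : dy η z = 0 := by
  simp [dy, fderiv_eq_zero_of_notMem_tsupport hz]

lemma IsTest.fderiv_apply (h : IsTest Ω η) (v : ℂ) : IsTest Ω fun z => fderiv ℝ η z v := by
  have hs : tsupport (fun z => fderiv ℝ η z v) ⊆ tsupport η := by
    refine closure_minimal (fun z hz => ?_) isClosed_closure
    by_contra h'
    exact hz (by simp [fderiv_eq_zero_of_notMem_tsupport h'])
  refine ⟨(h.smooth.fderiv_right (m := ∞) (by simp)).clm_apply contDiff_const, ?_,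
    hs.trans h.support⟩
  exact h.isCompact.of_isClosed_subset isClosed_closure hs

lemma IsTest.dx (h : IsTest Ω η) : IsTest Ω (dx η) := h.fderiv_apply 1
lemma IsTest.dy (h : IsTest Ω η) : IsTest Ω (dy η) := h.fderiv_apply Complex.I

lemma IsTest.clm_comp {G : Type*} [NormedAddCommGroup G] [NormedSpace ℝ G] (h : IsTest Ω η)
    (L : F →L[ℝ] G) : IsTest Ω fun z => L (η z) := by
  have hs : tsupport (fun z => L (η z)) ⊆ tsupport η :=
    closure_mono fun z hz h0 => hz (by simp only [h0, map_zero])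
  exact ⟨L.contDiff.comp h.smooth, h.isCompact.of_isClosed_subset isClosed_closure hs,
    hs.trans h.support⟩

lemma IsTest.fderiv_clm_comp {G : Type*} [NormedAddCommGroup G] [NormedSpace ℝ G]
    (h : IsTest Ω η) (L : F →L[ℝ] G) (z v : ℂ) :
    fderiv ℝ (fun z => L (η z)) z v = L (fderiv ℝ η z v) := by
  have hd : DifferentiableAt ℝ η z := h.smooth.contDiffAt.differentiableAt (by simp)
  have := (L.hasFDerivAt.comp z hd.hasFDerivAt).fderiv
  simp only [Function.comp_def] at this
  rw [this]; rfl

end Test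

/-- Local square integrability on `Ω`. -/
def MemL2Loc (Ω : Set ℂ) (f : ℂ → ℂ) : Prop :=
  ∀ K : Set ℂ, IsCompact K → K ⊆ Ω → MemLp f 2 (volume.restrict K)

/-- The pair `(P, Q)` is a complex-valued `L²_loc` vector field on `Ω` whose weak divergence
`P_x + Q_y` vanishes. -/
structure IsDivFree (Ω : Set ℂ) (P Q : ℂ → ℂ) : Prop where
  memLp_x : MemL2Loc Ω P
  memLp_y : MemL2Loc Ω Q
  div : ∀ η : ℂ → ℂ, IsTest Ω η → ∫ z, (dx η z * P z + dy η z * Q z) = 0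

/-- Mollification commutes with weak differentiation at points whose `φ.rOut`-ball stays inside
the set to which the function is truncated; the mollifier itself is the test function. -/
lemma fderiv_mollify {Ω : Set ℂ} {f p : ℂ → ℂ} {v : ℂ}
    (hw : ∀ η : ℂ → ℝ, IsTest Ω η → ∫ z, fderiv ℝ η z v • f z = -∫ z, η z • p z)
    {K' : Set ℂ} (hK' : IsCompact K') (hK'Ω : K' ⊆ Ω) (hf : IntegrableOn f K')
    (φ : ContDiffBump (0 : ℂ)) {z : ℂ} (hz : closedBall z φ.rOut ⊆ K') :
    fderiv ℝ (φ.normed volume ⋆[lsmul ℝ ℝ, volume] K'.indicator f) z v =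
      (φ.normed volume ⋆[lsmul ℝ ℝ, volume] K'.indicator p) z := by
  set ρ : ℂ → ℝ := φ.normed volume with hρ
  have hρs : ContDiff ℝ ∞ ρ := φ.contDiff_normed
  have hρc : HasCompactSupport ρ := φ.hasCompactSupport_normed
  have hρt : tsupport ρ = closedBall 0 φ.rOut := φ.tsupport_normed_eq
  have hfi : LocallyIntegrable (K'.indicator f) volume :=
    ((integrable_indicator_iff hK'.measurableSet).2 hf).locallyIntegrable
  rw [(hρc.hasFDerivAt_convolution_left (lsmul ℝ ℝ) (hρs.of_le (by simp)) hfi z).fderiv]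
  have hdc : Continuous (fderiv ℝ ρ) := hρs.continuous_fderiv (by simp)
  have e1 : (fderiv ℝ ρ ⋆[(lsmul ℝ ℝ).precompL ℂ, volume] K'.indicator f) z v =
      ∫ t, fderiv ℝ ρ (z - t) v • K'.indicator f t := by
    have hi := (hρc.fderiv ℝ).convolutionExists_left ((lsmul ℝ ℝ).precompL ℂ) hdc hfi z
    rw [convolution_def, ContinuousLinearMap.integral_apply hi]
    rw [← integral_sub_left_eq_self (fun t => fderiv ℝ ρ (z - t) v • K'.indicator f t) volume z]
    simp [precompL_apply]
  rw [e1]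
  have hη : IsTest Ω fun t => ρ (z - t) := by
    have hs : tsupport (fun t => ρ (z - t)) ⊆ closedBall z φ.rOut := by
      refine closure_minimal (fun t ht => ?_) isClosed_closedBall
      have : z - t ∈ closedBall (0 : ℂ) φ.rOut := hρt ▸ subset_tsupport _ ht
      simpa [dist_comm, dist_eq_norm] using this
    exact ⟨hρs.comp (contDiff_const.sub contDiff_id),
      (isCompact_closedBall z φ.rOut).of_isClosed_subset isClosed_closure hs,
      hs.trans (hz.trans hK'Ω)⟩
  have hd : ∀ t, fderiv ℝ (fun t => ρ (z - t)) t v = -fderiv ℝ ρ (z - t) v := by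
    intro t
    have h1 : HasFDerivAt ρ (fderiv ℝ ρ (z - t)) (z - t) :=
      (hρs.contDiffAt.differentiableAt (by simp)).hasFDerivAt
    have h2 := h1.comp t ((hasFDerivAt_id (𝕜 := ℝ) t).const_sub z)
    have h3 : fderiv ℝ (fun t => ρ (z - t)) t = _ := h2.fderiv
    rw [h3]
    simp
  have hzero : ∀ t, t ∉ K' → z - t ∉ tsupport ρ := by
    intro t ht h
    rw [hρt] at h
    exact ht (hz (by simpa [dist_comm, dist_eq_norm] using h))
  have h1 := hw _ hη
  simp only [hd] at h1
  have e2 : ∫ t, fderiv ℝ ρ (z - t) v • K'.indicator f t =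
      -∫ t, -fderiv ℝ ρ (z - t) v • f t := by
    rw [← integral_neg]
    congr 1 with t
    by_cases ht : t ∈ K'
    · simp [ht]
    · simp [ht, fderiv_eq_zero_of_notMem_tsupport (hzero t ht)]
  rw [e2, h1, neg_neg, convolution_eq_swap]
  congr 1 with t
  by_cases ht : t ∈ K'
  · simp [ht]
  · simp [ht, image_eq_zero_of_notMem_tsupport (hzero t ht)]

/-- A continuous `W^{1,2}_loc` function is, near a compact set, the limit of smooth functions,
uniformly and with gradients converging in `L²`. -/
lemma HasWeakGradient.exists_smooth_approx {Ω : Set ℂ} (hΩ : IsOpen Ω) {f p q : ℂ → ℂ}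
    (hfc : ContinuousOn f Ω) (h : HasWeakGradient Ω f p q) {K : Set ℂ} (hK : IsCompact K)
    (hKΩ : K ⊆ Ω) :
    ∃ g : ℕ → ℂ → ℂ, (∀ n, ContDiff ℝ ∞ (g n)) ∧
      (∀ z ∈ K, Tendsto (fun n => g n z) atTop (𝓝 (f z))) ∧
      Tendsto (fun n => eLpNorm (fun z => dx (g n) z - p z) 2 (volume.restrict K)) atTop (𝓝 0) ∧
      Tendsto (fun n => eLpNorm (fun z => dy (g n) z - q z) 2 (volume.restrict K)) atTop
        (𝓝 0) := by
  obtain ⟨δ, hδ, hδΩ⟩ := hK.exists_cthickening_subset_open hΩ hKΩ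
  set K' := cthickening δ K with hK'def
  have hK' : IsCompact K' := hK.cthickening
  have hKK' : K ⊆ K' := self_subset_cthickening K
  set φ : ℕ → ContDiffBump (0 : ℂ) := fun n =>
    ⟨δ / (n + 2), δ / (n + 1), by positivity, by gcongr; norm_num⟩ with hφ
  have hφlim : Tendsto (fun n => (φ n).rOut) atTop (𝓝 0) :=
    tendsto_const_nhds.div_atTop (tendsto_natCast_atTop_atTop.atTop_add tendsto_const_nhds)
  have hφδ : ∀ n, (φ n).rOut ≤ δ := fun n =>
    div_le_self hδ.le (by have : (0 : ℝ) ≤ n := n.cast_nonneg; linarith)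
  have hball : ∀ n, ∀ z ∈ K, closedBall z (φ n).rOut ⊆ K' := fun n z hz =>
    (closedBall_subset_closedBall (hφδ n)).trans (closedBall_subset_cthickening hz δ)
  have hfi : IntegrableOn f K' :=
    (hfc.mono hδΩ).integrableOn_compact hK'
  have hL2 : ∀ r : ℂ → ℂ, MemLp r 2 (volume.restrict K') → ∀ v,
      (∀ η : ℂ → ℝ, IsTest Ω η → ∫ z, fderiv ℝ η z v • f z = -∫ z, η z • r z) →
      Tendsto (fun n => eLpNorm (fun z => fderiv ℝ
        ((φ n).normed volume ⋆[lsmul ℝ ℝ, volume] K'.indicator f) z v - r z) 2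
        (volume.restrict K)) atTop (𝓝 0) := by
    intro r hr v hv
    have hr' : MemLp (K'.indicator r) 2 volume :=
      (memLp_indicator_iff_restrict hK'.measurableSet).2 hr
    refine tendsto_of_tendsto_of_tendsto_of_le_of_le tendsto_const_nhds
      (tendsto_eLpNorm_mollify_sub hφlim hr') (fun n => zero_le) fun n => ?_
    refine le_trans (eLpNorm_congr_ae ?_).le (eLpNorm_mono_measure _ Measure.restrict_le_self)
    refine (ae_restrict_iff' hK.measurableSet).2 (Eventually.of_forall fun z hz => ?_)
    simp only
    rw [fderiv_mollify hv hK' hδΩ hfi (φ n) (hball n z hz), Set.indicator_of_mem (hKK' hz)]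
  refine ⟨fun n => (φ n).normed volume ⋆[lsmul ℝ ℝ, volume] K'.indicator f, fun n => ?_,
    fun z hz => ?_, hL2 p (h.memLp_x K' hK' hδΩ) 1 h.weak_x,
    hL2 q (h.memLp_y K' hK' hδΩ) Complex.I h.weak_y⟩
  · exact (φ n).hasCompactSupport_normed.contDiff_convolution_left (n := ⊤) _ (φ n).contDiff_normed
      ((integrable_indicator_iff hK'.measurableSet).2 hfi).locallyIntegrable
  · rw [Metric.tendsto_nhds]
    intro ε hε
    have hcz : ContinuousAt f z := hfc.continuousAt (hΩ.mem_nhds (hKΩ hz))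
    obtain ⟨r, hr, hrf⟩ := Metric.continuousAt_iff.1 hcz (ε / 2) (by positivity)
    filter_upwards [hφlim.eventually (gt_mem_nhds hr)] with n hn
    have hm : AEStronglyMeasurable (K'.indicator f) volume :=
      ((integrable_indicator_iff hK'.measurableSet).2 hfi).aestronglyMeasurable
    have hle := (φ n).dist_normed_convolution_le (x₀ := z) (ε := ε / 2) hm fun x hx => by
      rw [Set.indicator_of_mem (hKK' hz),
        Set.indicator_of_mem (hball n z hz (ball_subset_closedBall hx))]
      exact (hrf (lt_trans hx hn)).le
    rw [Set.indicator_of_mem (hKK' hz)] at hle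
    exact hle.trans_lt (half_lt_self hε)

/-! ### Testing a divergence-free field against `Φ(f) η` -/

section Limits

variable {α : Type*} [MeasurableSpace α] {ν : Measure α}

lemma aestronglyMeasurable_clm_apply {c : α → ℂ →L[ℝ] ℂ} {p : α → ℂ}
    (hc : AEStronglyMeasurable c ν) (hp : AEStronglyMeasurable p ν) :
    AEStronglyMeasurable (fun z => c z (p z)) ν :=
  (ContinuousLinearMap.id ℝ (ℂ →L[ℝ] ℂ)).aestronglyMeasurable_comp₂ hc hp

lemma memLp_clm_apply {c : α → ℂ →L[ℝ] ℂ} {p : α → ℂ} {C : ℝ}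
    (hc : AEStronglyMeasurable c ν) (hC : ∀ᵐ z ∂ν, ‖c z‖ ≤ C) (hp : MemLp p 2 ν) :
    MemLp (fun z => c z (p z)) 2 ν := by
  refine hp.of_le_mul (c := C) (aestronglyMeasurable_clm_apply hc hp.1) ?_
  filter_upwards [hC] with z hz
  exact (c z).le_of_opNorm_le hz _

/-- Passage to the limit in a product of a bounded factor converging almost everywhere, a factor
converging in `L²`, and a fixed `L²` factor. -/
lemma tendsto_integral_clm_mul {c : ℕ → α → ℂ →L[ℝ] ℂ} {c' : α → ℂ →L[ℝ] ℂ} {p : ℕ → α → ℂ}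
    {p' P : α → ℂ} {C : ℝ} (hc : ∀ n, AEStronglyMeasurable (c n) ν)
    (hC : ∀ n, ∀ᵐ z ∂ν, ‖c n z‖ ≤ C)
    (hlim : ∀ᵐ z ∂ν, Tendsto (fun n => c n z) atTop (𝓝 (c' z)))
    (hp : ∀ n, AEStronglyMeasurable (p n) ν) (hp' : MemLp p' 2 ν) (hP : MemLp P 2 ν)
    (hpp : Tendsto (fun n => eLpNorm (fun z => p n z - p' z) 2 ν) atTop (𝓝 0)) :
    Tendsto (fun n => ∫ z, c n z (p n z) * P z ∂ν) atTop (𝓝 (∫ z, c' z (p' z) * P z ∂ν)) := by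
  have hi1 : ∀ n, Integrable (fun z => c n z (p' z) * P z) ν := fun n =>
    (memLp_clm_apply (hc n) (hC n) hp').integrable_mul hP
  have t1 : Tendsto (fun n => ∫ z, c n z (p' z) * P z ∂ν) atTop
      (𝓝 (∫ z, c' z (p' z) * P z ∂ν)) := by
    refine tendsto_integral_of_dominated_convergence (fun z => C * (‖p' z‖ * ‖P z‖))
      (fun n => (hi1 n).1) ((hp'.norm.integrable_mul hP.norm).const_mul C) (fun n => ?_) ?_
    · filter_upwards [hC n] with z hz
      rw [norm_mul, ← mul_assoc]
      gcongr
      exact (c n z).le_of_opNorm_le hz _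
    · filter_upwards [hlim] with z hz
      exact ((((ContinuousLinearMap.apply ℝ ℂ (p' z)).continuous.tendsto _).comp hz).mul
        tendsto_const_nhds)
  have hnorm : ∀ n, eLpNorm (fun z => c n z (p n z - p' z) * P z) 1 ν ≤
      ENNReal.ofReal C * eLpNorm (fun z => p n z - p' z) 2 ν * eLpNorm P 2 ν := by
    intro n
    have hm := aestronglyMeasurable_clm_apply (hc n) ((hp n).sub hp'.1)
    refine (eLpNorm_smul_le_mul_eLpNorm (p := 2) (q := 2) (r := 1) hP.1 hm).trans ?_
    gcongr
    refine eLpNorm_le_mul_eLpNorm_of_ae_le_mul ?_ 2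
    filter_upwards [hC n] with z hz
    exact (c n z).le_of_opNorm_le hz _
  have t2 : Tendsto (fun n => eLpNorm (fun z => c n z (p n z - p' z) * P z) 1 ν) atTop
      (𝓝 0) := by
    refine tendsto_of_tendsto_of_tendsto_of_le_of_le tendsto_const_nhds ?_ (fun n => zero_le) hnorm
    have h1 := ENNReal.Tendsto.const_mul (a := ENNReal.ofReal C) hpp (Or.inr ENNReal.ofReal_ne_top)
    have h2 := ENNReal.Tendsto.mul_const (b := eLpNorm P 2 ν) h1 (Or.inr hP.2.ne)
    simpa using h2
  have hm2 : ∀ n, AEStronglyMeasurable (fun z => c n z (p n z - p' z) * P z) ν := fun n =>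
    (aestronglyMeasurable_clm_apply (hc n) ((hp n).sub hp'.1)).mul hP.1
  have hi2 : ∀ᶠ n in atTop, Integrable (fun z => c n z (p n z - p' z) * P z) ν := by
    filter_upwards [t2.eventually (gt_mem_nhds ENNReal.zero_lt_top)] with n hn
    exact memLp_one_iff_integrable.1 ⟨hm2 n, hn⟩
  have t3 : Tendsto (fun n => ∫ z, c n z (p n z - p' z) * P z ∂ν) atTop (𝓝 0) := by
    have := tendsto_integral_of_L1' (μ := ν) (fun _ => (0 : ℂ)) aestronglyMeasurable_const hi2
      (by simpa [Pi.sub_def] using t2)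
    simpa using this
  have t4 := t3.add t1
  rw [zero_add] at t4
  refine t4.congr' ?_
  filter_upwards [hi2] with n hn
  rw [← integral_add hn (hi1 n)]
  congr 1 with z
  rw [map_sub]; ring

end Limits

section L2Loc

variable {Ω : Set ℂ}

lemma MemL2Loc.clm_apply {c : ℂ → ℂ →L[ℝ] ℂ} {p : ℂ → ℂ} (hc : ContinuousOn c Ω)
    (hp : MemL2Loc Ω p) : MemL2Loc Ω fun z => c z (p z) := by
  intro K hK hKΩ
  obtain ⟨C, hC⟩ := hK.exists_bound_of_continuousOn (hc.mono hKΩ)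
  exact memLp_clm_apply ((hc.mono hKΩ).aestronglyMeasurable_of_isCompact hK hK.measurableSet)
    ((ae_restrict_iff' hK.measurableSet).2 (Eventually.of_forall hC)) (hp K hK hKΩ)

lemma MemL2Loc.mul {c p : ℂ → ℂ} (hc : ContinuousOn c Ω) (hp : MemL2Loc Ω p) :
    MemL2Loc Ω fun z => c z * p z :=
  MemL2Loc.clm_apply (c := fun z => ContinuousLinearMap.mul ℝ ℂ (c z))
    ((ContinuousLinearMap.mul ℝ ℂ).continuous.comp_continuousOn hc) hp

lemma memL2Loc_of_continuousOn {f : ℂ → ℂ} (hf : ContinuousOn f Ω) : MemL2Loc Ω f := by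
  intro K hK hKΩ
  have hm := (hf.mono hKΩ).aestronglyMeasurable_of_isCompact hK hK.measurableSet (μ := volume)
  obtain ⟨C, hC⟩ := hK.exists_bound_of_continuousOn (hf.mono hKΩ)
  have : IsFiniteMeasure (volume.restrict K) := ⟨by simpa using hK.measure_lt_top⟩
  exact MemLp.of_bound hm C ((ae_restrict_iff' hK.measurableSet).2 (Eventually.of_forall hC))

lemma MemL2Loc.locallyIntegrableOn {f : ℂ → ℂ} (hΩ : IsOpen Ω) (h : MemL2Loc Ω f) :
    LocallyIntegrableOn f Ω volume := by
  rw [locallyIntegrableOn_iff hΩ.isLocallyClosed]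
  intro K hKΩ hK
  have : IsFiniteMeasure (volume.restrict K) := ⟨by simpa using hK.measure_lt_top⟩
  exact (h K hK hKΩ).integrable (by norm_num)

lemma integral_eq_setIntegral_of_tsupport_subset {F : Type*} [Zero F] {E : Type*}
    [NormedAddCommGroup E] [NormedSpace ℝ E] {η : ℂ → F} {G : ℂ → E} {K : Set ℂ}
    (hK : tsupport η ⊆ K) (hG : ∀ z, z ∉ tsupport η → G z = 0) :
    ∫ z, G z = ∫ z in K, G z :=
  (setIntegral_eq_integral_of_forall_compl_eq_zero fun z hz => hG z fun h => hz (hK h)).symm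

lemma IsTest.integrable_mul {η : ℂ → ℂ} (hη : IsTest Ω η) {P : ℂ → ℂ} (hP : MemL2Loc Ω P) :
    Integrable fun z => η z * P z := by
  have hK := hη.isCompact
  have h1 := (memL2Loc_of_continuousOn hη.smooth.continuous.continuousOn (Ω := Ω)) _ hK hη.support
  have h2 : IntegrableOn (fun z => η z * P z) (tsupport η) :=
    h1.integrable_mul (hP _ hK hη.support)
  refine h2.integrable_of_forall_notMem_eq_zero ?_
  intro z hz
  simp [image_eq_zero_of_notMem_tsupport hz]

lemma IsTest.integrable_mul_mul {η : ℂ → ℂ} (hη : IsTest Ω η) {p P : ℂ → ℂ}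
    (hp : MemL2Loc Ω p) (hP : MemL2Loc Ω P) : Integrable fun z => η z * (p z * P z) := by
  have hK := hη.isCompact
  have h1 : MemL2Loc Ω fun z => η z * p z := hp.mul hη.smooth.continuous.continuousOn
  have h2 : IntegrableOn (fun z => η z * p z * P z) (tsupport η) :=
    (h1 _ hK hη.support).integrable_mul (hP _ hK hη.support)
  simp only [← mul_assoc]
  refine h2.integrable_of_forall_notMem_eq_zero ?_
  intro z hz
  simp [image_eq_zero_of_notMem_tsupport hz]

end L2Loc

lemma integral_fderiv_eq_zero {Ω : Set ℂ} {η : ℂ → ℂ} (hη : IsTest Ω η) (v : ℂ) :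
    ∫ z, fderiv ℝ η z v = 0 := by
  have h := integral_bilinear_hasFDerivAt_right_eq_neg_left_of_integrable (μ := volume)
    (B := ContinuousLinearMap.mul ℝ ℂ) (f := fun _ => (1 : ℂ)) (f' := fun _ => 0)
    (g := η) (g' := fderiv ℝ η) (v := v) (by simp)
    (by simpa using ((hη.fderiv_apply v).smooth.continuous.integrable_of_hasCompactSupport
      (hη.fderiv_apply v).compact))
    (by simpa using (hη.smooth.continuous.integrable_of_hasCompactSupport hη.compact))
    (fun z _ => hasFDerivAt_const _ _)
    (fun z _ => (hη.smooth.contDiffAt.differentiableAt (by simp)).hasFDerivAt)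
  simpa using h

/-- A divergence-free field may be tested against `Φ(f) η`, where `f` is a continuous
`W^{1,2}_loc` function and `Φ` is smooth. -/
theorem IsDivFree.integral_comp_mul_eq_zero {Ω : Set ℂ} (hΩ : IsOpen Ω) {f p q : ℂ → ℂ}
    (hfc : ContinuousOn f Ω) (hf : HasWeakGradient Ω f p q) {P Q : ℂ → ℂ}
    (hPQ : IsDivFree Ω P Q) {V : Set ℂ} (hV : IsOpen V) {Φ : ℂ → ℂ} (hΦ : ContDiffOn ℝ ∞ Φ V)
    (hfV : Set.MapsTo f Ω V) {η : ℂ → ℂ} (hη : IsTest Ω η) :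
    ∫ z, (Φ (f z) * (dx η z * P z + dy η z * Q z) +
      η z * (fderiv ℝ Φ (f z) (p z) * P z + fderiv ℝ Φ (f z) (q z) * Q z)) = 0 := by
  set K := tsupport η with hKdef
  have hK : IsCompact K := hη.isCompact
  have hKΩ : K ⊆ Ω := hη.support
  obtain ⟨Ψ, hΨ, hΨc, hΨΦ⟩ := exists_contDiff_eventuallyEq_of_isCompact hV hΦ
    (hK.image_of_continuousOn (hfc.mono hKΩ))
    (Set.image_subset_iff.2 fun z hz => hfV (hKΩ hz))
  obtain ⟨g, hg, hgf, hgx, hgy⟩ := hf.exists_smooth_approx hΩ hfc hK hKΩ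
  have hΨd : Continuous (fderiv ℝ Ψ) := hΨ.continuous_fderiv (by simp)
  obtain ⟨C₀, hC₀⟩ := hΨ.continuous.bounded_above_of_compact_support hΨc
  obtain ⟨C₁, hC₁⟩ := hΨd.bounded_above_of_compact_support (hΨc.fderiv ℝ)
  obtain ⟨C₂, hC₂⟩ := hη.smooth.continuous.bounded_above_of_compact_support hη.compact
  have hP := hPQ.memLp_x K hK hKΩ
  have hQ := hPQ.memLp_y K hK hKΩ
  set c : ℕ → ℂ → ℂ →L[ℝ] ℂ := fun n z => η z • fderiv ℝ Ψ (g n z) with hc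
  set c' : ℂ → ℂ →L[ℝ] ℂ := fun z => η z • fderiv ℝ Ψ (f z) with hc'
  have hcc : ∀ n, Continuous (c n) := fun n =>
    hη.smooth.continuous.smul (hΨd.comp (hg n).continuous)
  have hcC : ∀ n z, ‖c n z‖ ≤ C₂ * C₁ := fun n z => by
    rw [hc]
    simp only [norm_smul]
    exact mul_le_mul (hC₂ z) (hC₁ _) (norm_nonneg _) ((norm_nonneg _).trans (hC₂ 0))
  have hclim : ∀ᵐ z ∂volume.restrict K, Tendsto (fun n => c n z) atTop (𝓝 (c' z)) := by
    refine (ae_restrict_iff' hK.measurableSet).2 (Eventually.of_forall fun z hz => ?_)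
    exact tendsto_const_nhds.smul ((hΨd.tendsto _).comp (hgf z hz))
  have hdg : ∀ n v, Continuous fun z => fderiv ℝ (g n) z v := fun n v =>
    ((hg n).continuous_fderiv (by simp)).clm_apply continuous_const
  have hDP : IntegrableOn (fun z => dx η z * P z + dy η z * Q z) K :=
    ((hη.dx.integrable_mul hPQ.memLp_x).add (hη.dy.integrable_mul hPQ.memLp_y)).integrableOn
  -- The three limits.
  have tA : Tendsto (fun n => ∫ z in K, Ψ (g n z) * (dx η z * P z + dy η z * Q z)) atTop
      (𝓝 (∫ z in K, Ψ (f z) * (dx η z * P z + dy η z * Q z))) := by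
    refine tendsto_integral_of_dominated_convergence
      (fun z => C₀ * ‖dx η z * P z + dy η z * Q z‖)
      (fun n => ((hΨ.continuous.comp (hg n).continuous).aestronglyMeasurable.mul hDP.1))
      (hDP.norm.const_mul C₀) (fun n => Eventually.of_forall fun z => ?_) ?_
    · rw [norm_mul]
      gcongr
      exact hC₀ _
    · refine (ae_restrict_iff' hK.measurableSet).2 (Eventually.of_forall fun z hz => ?_)
      exact ((hΨ.continuous.tendsto _).comp (hgf z hz)).mul tendsto_const_nhds
  have tB := tendsto_integral_clm_mul (fun n => (hcc n).aestronglyMeasurable)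
    (fun n => Eventually.of_forall (hcC n)) hclim (fun n => (hdg n 1).aestronglyMeasurable)
    (hf.memLp_x K hK hKΩ) hP hgx
  have tC := tendsto_integral_clm_mul (fun n => (hcc n).aestronglyMeasurable)
    (fun n => Eventually.of_forall (hcC n)) hclim
    (fun n => (hdg n Complex.I).aestronglyMeasurable) (hf.memLp_y K hK hKΩ) hQ hgy
  have hi : ∀ (r R : ℂ → ℂ) (d : ℂ → ℂ →L[ℝ] ℂ), ContinuousOn d K →
      MemLp r 2 (volume.restrict K) → MemLp R 2 (volume.restrict K) →
      IntegrableOn (fun z => d z (r z) * R z) K := by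
    intro r R d hd hr hR
    obtain ⟨C, hC⟩ := hK.exists_bound_of_continuousOn hd
    exact (memLp_clm_apply (hd.aestronglyMeasurable_of_isCompact hK hK.measurableSet)
      ((ae_restrict_iff' hK.measurableSet).2 (Eventually.of_forall hC)) hr).integrable_mul hR
  have hc'c : ContinuousOn c' K :=
    hη.smooth.continuous.continuousOn.smul (hΨd.comp_continuousOn (hfc.mono hKΩ))
  -- The identity for the smooth approximations: `Ψ(g n) η` is a test function.
  have hzero : ∀ n, (∫ z in K, Ψ (g n z) * (dx η z * P z + dy η z * Q z)) +
      (∫ z in K, c n z (fderiv ℝ (g n) z 1) * P z) +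
      (∫ z in K, c n z (fderiv ℝ (g n) z Complex.I) * Q z) = 0 := by
    intro n
    have hξ : IsTest Ω fun z => Ψ (g n z) * η z := by
      have hs : tsupport (fun z => Ψ (g n z) * η z) ⊆ tsupport η :=
        closure_mono fun z hz h0 => hz (by simp only [h0, mul_zero])
      exact ⟨(hΨ.comp (hg n)).mul hη.smooth, hK.of_isClosed_subset isClosed_closure hs,
        hs.trans hKΩ⟩
    have hξd : ∀ z v, fderiv ℝ (fun z => Ψ (g n z) * η z) z v =
        Ψ (g n z) * fderiv ℝ η z v + c n z (fderiv ℝ (g n) z v) := by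
      intro z v
      have h1 : HasFDerivAt (g n) (fderiv ℝ (g n) z) z :=
        ((hg n).contDiffAt.differentiableAt (by simp)).hasFDerivAt
      have h2 : HasFDerivAt Ψ (fderiv ℝ Ψ (g n z)) (g n z) :=
        (hΨ.contDiffAt.differentiableAt (by simp)).hasFDerivAt
      have h3 : HasFDerivAt η (fderiv ℝ η z) z :=
        (hη.smooth.contDiffAt.differentiableAt (by simp)).hasFDerivAt
      have h4 := ((h2.comp z h1).mul h3).fderiv
      simp only [Function.comp_def] at h4
      have h5 : (fun z => Ψ (g n z) * η z) = (fun z => Ψ (g n z)) * η := rfl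
      rw [h5, h4]
      simp [hc]
    have h0 := hPQ.div _ hξ
    rw [← integral_add, ← integral_add, ← h0,
      integral_eq_setIntegral_of_tsupport_subset (η := η) (K := K) le_rfl]
    · congr 1 with z
      simp only [dx, dy, hξd]
      ring
    · intro z hz
      simp [dx, dy, hξd, hc, image_eq_zero_of_notMem_tsupport hz,
        fderiv_eq_zero_of_notMem_tsupport hz]
    · refine Integrable.add ?_ ?_
      · exact hDP.bdd_mul (hΨ.continuous.comp (hg n).continuous).aestronglyMeasurable
          (Eventually.of_forall fun z => hC₀ _)
      · exact hi _ _ _ (hcc n).continuousOn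
          (memL2Loc_of_continuousOn (Ω := K) (hdg n 1).continuousOn K hK le_rfl) hP
    · exact hi _ _ _ (hcc n).continuousOn
          (memL2Loc_of_continuousOn (Ω := K) (hdg n Complex.I).continuousOn K hK le_rfl) hQ
    · exact hDP.bdd_mul (hΨ.continuous.comp (hg n).continuous).aestronglyMeasurable
          (Eventually.of_forall fun z => hC₀ _)
    · exact hi _ _ _ (hcc n).continuousOn
          (memL2Loc_of_continuousOn (Ω := K) (hdg n 1).continuousOn K hK le_rfl) hP
  have hfin := tendsto_nhds_unique ((tA.add tB).add tC)
    (tendsto_const_nhds.congr fun n => (hzero n).symm)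
  have hiA : IntegrableOn (fun z => Ψ (f z) * (dx η z * P z + dy η z * Q z)) K :=
    hDP.bdd_mul ((hΨ.continuous.comp_continuousOn
      (hfc.mono hKΩ)).aestronglyMeasurable_of_isCompact hK hK.measurableSet)
      (Eventually.of_forall fun z => hC₀ _)
  have hiB := hi p P c' hc'c (hf.memLp_x K hK hKΩ) hP
  have hiC := hi q Q c' hc'c (hf.memLp_y K hK hKΩ) hQ
  have hiAB : IntegrableOn (fun z => Ψ (f z) * (dx η z * P z + dy η z * Q z) +
      c' z (p z) * P z) K := hiA.add hiB
  rw [← integral_add hiA hiB, ← integral_add hiAB hiC] at hfin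
  rw [integral_eq_setIntegral_of_tsupport_subset (η := η) (K := K) le_rfl, ← hfin]
  · refine setIntegral_congr_fun hK.measurableSet fun z hz => ?_
    have h1 := hΨΦ (f z) ⟨z, hz, rfl⟩
    simp only [hc', h1.eq_of_nhds, h1.fderiv_eq]
    simp
    ring
  · intro z hz
    simp [image_eq_zero_of_notMem_tsupport hz, dx_of_notMem_tsupport hz, dy_of_notMem_tsupport hz]

/-! ### Weak gradients and the flux `A ∇h` -/

section Test

variable {F G : Type*} [NormedAddCommGroup F] [NormedSpace ℝ F] [NormedAddCommGroup G]
  [NormedSpace ℝ G] {Ω : Set ℂ} {η : ℂ → F}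

lemma IsTest.dx_clm_comp (h : IsTest Ω η) (L : F →L[ℝ] G) (z : ℂ) :
    QCHarmonic.dx (fun z => L (η z)) z = L (QCHarmonic.dx η z) := h.fderiv_clm_comp L z 1

lemma IsTest.dy_clm_comp (h : IsTest Ω η) (L : F →L[ℝ] G) (z : ℂ) :
    QCHarmonic.dy (fun z => L (η z)) z = L (QCHarmonic.dy η z) :=
  h.fderiv_clm_comp L z Complex.I

end Test

section WeakGradient

variable {Ω : Set ℂ} {f p q : ℂ → ℂ}

lemma HasWeakGradient.mono {Ω' : Set ℂ} (h : HasWeakGradient Ω f p q) (hs : Ω' ⊆ Ω) :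
    HasWeakGradient Ω' f p q :=
  ⟨fun K hK hK' => h.memLp K hK (hK'.trans hs), fun K hK hK' => h.memLp_x K hK (hK'.trans hs),
    fun K hK hK' => h.memLp_y K hK (hK'.trans hs), fun η hη => h.weak_x η (hη.mono hs),
    fun η hη => h.weak_y η (hη.mono hs)⟩

lemma MemL2Loc.ae_eq_of_integral_smul_eq (hΩ : IsOpen Ω) {p p' : ℂ → ℂ} (hp : MemL2Loc Ω p)
    (hp' : MemL2Loc Ω p')
    (h : ∀ η : ℂ → ℝ, IsTest Ω η → ∫ z, η z • p z = ∫ z, η z • p' z) :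
    ∀ᵐ z ∂volume.restrict Ω, p z = p' z := by
  have h1 := hΩ.ae_eq_zero_of_integral_contDiff_smul_eq_zero (μ := volume)
    ((hp.locallyIntegrableOn hΩ).sub (hp'.locallyIntegrableOn hΩ)) ?_
  · rw [ae_restrict_iff' hΩ.measurableSet]
    filter_upwards [h1] with z hz hzΩ
    exact sub_eq_zero.1 (hz hzΩ)
  · intro η h1 h2 h3
    have hη : IsTest Ω η := ⟨h1, h2, h3⟩
    have hηc := hη.clm_comp Complex.ofRealCLM
    have e : ∀ r : ℂ → ℂ, (fun z => η z • r z) = fun z => Complex.ofRealCLM (η z) * r z :=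
      fun r => by ext z; simp
    simp only [Pi.sub_apply, smul_sub]
    rw [integral_sub, h η hη, sub_self]
    · rw [e]; exact hηc.integrable_mul hp
    · rw [e]; exact hηc.integrable_mul hp'

/-- Uniqueness of the weak gradient. -/
lemma HasWeakGradient.ae_eq (hΩ : IsOpen Ω) {p' q' : ℂ → ℂ} (h : HasWeakGradient Ω f p q)
    (h' : HasWeakGradient Ω f p' q') :
    (∀ᵐ z ∂volume.restrict Ω, p z = p' z) ∧ ∀ᵐ z ∂volume.restrict Ω, q z = q' z :=
  ⟨MemL2Loc.ae_eq_of_integral_smul_eq hΩ h.memLp_x h'.memLp_x fun η hη => by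
      rw [← neg_inj, ← h.weak_x η hη, h'.weak_x η hη],
    MemL2Loc.ae_eq_of_integral_smul_eq hΩ h.memLp_y h'.memLp_y fun η hη => by
      rw [← neg_inj, ← h.weak_y η hη, h'.weak_y η hη]⟩

lemma isDivFree_const (Ω : Set ℂ) (a b : ℂ) : IsDivFree Ω (fun _ => a) fun _ => b := by
  refine ⟨memL2Loc_of_continuousOn continuousOn_const, memL2Loc_of_continuousOn continuousOn_const,
    fun η hη => ?_⟩
  rw [integral_add (hη.dx.integrable_mul (memL2Loc_of_continuousOn continuousOn_const))
    (hη.dy.integrable_mul (memL2Loc_of_continuousOn continuousOn_const)),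
    integral_mul_const, integral_mul_const]
  simp [dx, dy, integral_fderiv_eq_zero hη]

lemma continuousOn_fderiv_comp (hfc : ContinuousOn f Ω) {V : Set ℂ} (hV : IsOpen V)
    {Φ : ℂ → ℂ} (hΦ : ContDiffOn ℝ ∞ Φ V) (hfV : Set.MapsTo f Ω V) :
    ContinuousOn (fun z => fderiv ℝ Φ (f z)) Ω :=
  (hΦ.continuousOn_fderiv_of_isOpen hV (by simp)).comp hfc hfV

/-- The chain rule: this is `IsDivFree.integral_comp_mul_eq_zero` for the constant fields. -/
lemma HasWeakGradient.comp (hΩ : IsOpen Ω) (hfc : ContinuousOn f Ω)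
    (hf : HasWeakGradient Ω f p q) {V : Set ℂ} (hV : IsOpen V) {Φ : ℂ → ℂ}
    (hΦ : ContDiffOn ℝ ∞ Φ V) (hfV : Set.MapsTo f Ω V) :
    HasWeakGradient Ω (fun z => Φ (f z)) (fun z => fderiv ℝ Φ (f z) (p z))
      fun z => fderiv ℝ Φ (f z) (q z) := by
  have hc := continuousOn_fderiv_comp hfc hV hΦ hfV
  have hx : MemL2Loc Ω fun z => fderiv ℝ Φ (f z) (p z) := MemL2Loc.clm_apply hc hf.memLp_x
  have hy : MemL2Loc Ω fun z => fderiv ℝ Φ (f z) (q z) := MemL2Loc.clm_apply hc hf.memLp_y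
  have h0 : MemL2Loc Ω fun z => Φ (f z) :=
    memL2Loc_of_continuousOn (hΦ.continuousOn.comp hfc hfV)
  refine ⟨h0, hx, hy, fun η hη => ?_, fun η hη => ?_⟩
  · have hηc := hη.clm_comp Complex.ofRealCLM
    have h := (isDivFree_const Ω 1 0).integral_comp_mul_eq_zero hΩ hfc hf hV hΦ hfV hηc
    have i1 := hηc.dx.integrable_mul h0
    have i2 := hηc.integrable_mul hx
    rw [eq_neg_iff_add_eq_zero, ← h]
    simp only [dx, hη.fderiv_clm_comp] at i1 ⊢
    simp only [Complex.ofRealCLM_apply, Complex.real_smul] at i1 i2 ⊢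
    rw [← integral_add i1 i2]
    congr 1 with z
    ring
  · have hηc := hη.clm_comp Complex.ofRealCLM
    have h := (isDivFree_const Ω 0 1).integral_comp_mul_eq_zero hΩ hfc hf hV hΦ hfV hηc
    have i1 := hηc.dy.integrable_mul h0
    have i2 := hηc.integrable_mul hy
    rw [eq_neg_iff_add_eq_zero, ← h]
    simp only [dy, hη.fderiv_clm_comp] at i1 ⊢
    simp only [Complex.ofRealCLM_apply, Complex.real_smul] at i1 i2 ⊢
    rw [← integral_add i1 i2]
    congr 1 with z
    ring

/-- The mixed second partial derivatives of a `W^{1,2}_loc` function agree. -/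
lemma HasWeakGradient.integral_dx_smul_eq_integral_dy_smul (h : HasWeakGradient Ω f p q) :
    ∀ η : ℂ → ℝ, IsTest Ω η → ∫ z, dx η z • q z = ∫ z, dy η z • p z := by
  intro η hη
  rw [← neg_inj, ← h.weak_y _ hη.dx, ← h.weak_x _ hη.dy]
  congr 1 with z
  have hs : IsSymmSndFDerivAt ℝ η z := hη.smooth.contDiffAt.isSymmSndFDerivAt (by
    simpa using ENat.LEInfty.out)
  have hd : DifferentiableAt ℝ (fderiv ℝ η) z :=
    (hη.smooth.fderiv_right (m := ∞) (by simp)).contDiffAt.differentiableAt (by simp)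
  have e : ∀ v w, fderiv ℝ (fun z => fderiv ℝ η z v) z w = fderiv ℝ (fderiv ℝ η) z w v := by
    intro v w
    rw [fderiv_clm_apply hd (differentiableAt_const v)]
    simp
  congr 1
  change fderiv ℝ (fun z => fderiv ℝ η z 1) z Complex.I
    = fderiv ℝ (fun z => fderiv ℝ η z Complex.I) z 1
  rw [e, e]
  exact hs.eq _ _

end WeakGradient

section Flux

/-- The first component of the complex flux `A ∇h`, where `A` has Beltrami coefficient `m` and
`h_x = p`, `h_y = q`. -/
def fluxX (m p q : ℂ → ℂ) (z : ℂ) : ℂ :=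
  (coeffMatrix (m z) 0 0 : ℂ) * p z + (coeffMatrix (m z) 0 1 : ℂ) * q z

/-- The second component of the complex flux `A ∇h`. -/
def fluxY (m p q : ℂ → ℂ) (z : ℂ) : ℂ :=
  (coeffMatrix (m z) 1 0 : ℂ) * p z + (coeffMatrix (m z) 1 1 : ℂ) * q z

lemma sq_add_sq_le_of_norm_le {m : ℂ} {k : ℝ} (hm : ‖m‖ ≤ k) : m.re ^ 2 + m.im ^ 2 ≤ k ^ 2 := by
  have h := Complex.sq_norm m
  rw [Complex.normSq_apply] at h
  nlinarith [norm_nonneg m]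

lemma one_sub_sq_pos {m : ℂ} (hm : ‖m‖ < 1) : 0 < 1 - m.re ^ 2 - m.im ^ 2 := by
  have h := Complex.sq_norm m
  rw [Complex.normSq_apply] at h
  nlinarith [norm_nonneg m]

lemma abs_coeffMatrix_le {m : ℂ} {k : ℝ} (hm : ‖m‖ ≤ k) (hk : k < 1) (i j : Fin 2) :
    |coeffMatrix m i j| ≤ 4 / (1 - k ^ 2) := by
  have h1 := sq_add_sq_le_of_norm_le hm
  have h0 : 0 ≤ k := (norm_nonneg m).trans hm
  have hk2 : 0 < 1 - k ^ 2 := by nlinarith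
  have hd : 1 - k ^ 2 ≤ 1 - m.re ^ 2 - m.im ^ 2 := by linarith
  have hd0 : 0 < 1 - m.re ^ 2 - m.im ^ 2 := by linarith
  have hm1 : m.re ^ 2 + m.im ^ 2 ≤ 1 := by nlinarith
  have key : ∀ x : ℝ, |x| ≤ 4 → |x / (1 - m.re ^ 2 - m.im ^ 2)| ≤ 4 / (1 - k ^ 2) := by
    intro x hx
    rw [abs_div, abs_of_pos hd0]
    gcongr
  fin_cases i <;> fin_cases j <;> simp only [coeffMatrix, Fin.zero_eta, Fin.mk_one, Fin.isValue,
    Matrix.of_apply, Matrix.cons_val', Matrix.cons_val_zero, Matrix.cons_val_one,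
    Matrix.cons_val_fin_one] <;>
    refine key _ (abs_le.2 ⟨?_, ?_⟩) <;> nlinarith [sq_nonneg (m.re + 1), sq_nonneg (m.re - 1),
      sq_nonneg (m.im + 1), sq_nonneg (m.im - 1), sq_nonneg m.im]

lemma measurable_coeffMatrix (i j : Fin 2) : Measurable fun m : ℂ => coeffMatrix m i j := by
  fin_cases i <;> fin_cases j <;> simp [coeffMatrix] <;> fun_prop

variable {Ω : Set ℂ} {m : ℂ → ℂ} {k : ℝ}

lemma aestronglyMeasurable_coeffMatrix (hm : AEStronglyMeasurable m (volume.restrict Ω))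
    (i j : Fin 2) :
    AEStronglyMeasurable (fun z => coeffMatrix (m z) i j) (volume.restrict Ω) :=
  ((measurable_coeffMatrix i j).comp_aemeasurable hm.aemeasurable).aestronglyMeasurable

lemma memL2Loc_coeffMatrix_mul (hm : AEStronglyMeasurable m (volume.restrict Ω))
    (hk : k < 1) (hmk : ∀ᵐ z ∂volume.restrict Ω, ‖m z‖ ≤ k) {p : ℂ → ℂ} (hp : MemL2Loc Ω p)
    (i j : Fin 2) : MemL2Loc Ω fun z => (coeffMatrix (m z) i j : ℂ) * p z := by
  intro K hK hKΩ
  have hle : volume.restrict K ≤ volume.restrict Ω := Measure.restrict_mono hKΩ le_rfl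
  refine (hp K hK hKΩ).of_le_mul (c := 4 / (1 - k ^ 2)) ?_ ?_
  · exact (Complex.continuous_ofReal.comp_aestronglyMeasurable
      ((aestronglyMeasurable_coeffMatrix hm i j).mono_measure hle)).mul (hp K hK hKΩ).1
  · filter_upwards [ae_mono hle hmk] with z hz
    rw [norm_mul, Complex.norm_real, Real.norm_eq_abs]
    gcongr
    exact abs_coeffMatrix_le hz hk i j

lemma memL2Loc_fluxX (hm : AEStronglyMeasurable m (volume.restrict Ω))
    (hk : k < 1) (hmk : ∀ᵐ z ∂volume.restrict Ω, ‖m z‖ ≤ k) {p q : ℂ → ℂ} (hp : MemL2Loc Ω p)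
    (hq : MemL2Loc Ω q) : MemL2Loc Ω (fluxX m p q) := fun K hK hKΩ =>
  (memL2Loc_coeffMatrix_mul hm hk hmk hp 0 0 K hK hKΩ).add
    (memL2Loc_coeffMatrix_mul hm hk hmk hq 0 1 K hK hKΩ)

lemma memL2Loc_fluxY (hm : AEStronglyMeasurable m (volume.restrict Ω))
    (hk : k < 1) (hmk : ∀ᵐ z ∂volume.restrict Ω, ‖m z‖ ≤ k) {p q : ℂ → ℂ} (hp : MemL2Loc Ω p)
    (hq : MemL2Loc Ω q) : MemL2Loc Ω (fluxY m p q) := fun K hK hKΩ =>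
  (memL2Loc_coeffMatrix_mul hm hk hmk hp 1 0 K hK hKΩ).add
    (memL2Loc_coeffMatrix_mul hm hk hmk hq 1 1 K hK hKΩ)

lemma weakDivFree_iff_real {p q : ℂ → ℂ} (hP : MemL2Loc Ω (fluxX m p q))
    (hQ : MemL2Loc Ω (fluxY m p q)) :
    WeakDivFree Ω (fun z => coeffMatrix (m z)) p q ↔ ∀ η : ℂ → ℝ, IsTest Ω η →
      ∫ z, (dx η z • fluxX m p q z + dy η z • fluxY m p q z) = 0 := by
  refine forall₂_congr fun η hη => ?_
  have hηc := hη.clm_comp Complex.ofRealCLM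
  have hi : Integrable fun z => dx η z • fluxX m p q z + dy η z • fluxY m p q z := by
    have i1 := (hηc.dx.integrable_mul hP).add (hηc.dy.integrable_mul hQ)
    refine i1.congr (Eventually.of_forall fun z => ?_)
    simp only [Pi.add_apply, hη.dx_clm_comp, hη.dy_clm_comp]
    simp
  have hre := Complex.reCLM.integral_comp_comm hi
  have him := Complex.imCLM.integral_comp_comm hi
  rw [Complex.ext_iff, Complex.zero_re, Complex.zero_im]
  simp only [Complex.reCLM_apply, Complex.imCLM_apply] at hre him
  rw [← hre, ← him]
  simp [fluxX, fluxY, Matrix.mulVec, dotProduct, Fin.sum_univ_two, mul_add]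

/-- Since the coefficients are real, the two real equations for `u` and `v` are one equation for
the complex flux of `u + iv`, tested against complex functions. -/
lemma weakDivFree_iff_isDivFree {p q : ℂ → ℂ} (hP : MemL2Loc Ω (fluxX m p q))
    (hQ : MemL2Loc Ω (fluxY m p q)) :
    WeakDivFree Ω (fun z => coeffMatrix (m z)) p q ↔
      IsDivFree Ω (fluxX m p q) (fluxY m p q) := by
  rw [weakDivFree_iff_real hP hQ]
  constructor
  · intro h
    refine ⟨hP, hQ, fun η hη => ?_⟩
    have h1 := h _ (hη.clm_comp Complex.reCLM)
    have h2 := h _ (hη.clm_comp Complex.imCLM)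
    have i1 := ((hη.clm_comp (Complex.ofRealCLM ∘L Complex.reCLM)).dx.integrable_mul hP).add
      ((hη.clm_comp (Complex.ofRealCLM ∘L Complex.reCLM)).dy.integrable_mul hQ)
    have i2 := (((hη.clm_comp (Complex.ofRealCLM ∘L Complex.imCLM)).dx.integrable_mul hP).add
      ((hη.clm_comp (Complex.ofRealCLM ∘L Complex.imCLM)).dy.integrable_mul hQ)).const_mul
        Complex.I
    have e : ∀ z, dx η z * fluxX m p q z + dy η z * fluxY m p q z =
        (dx (fun z => Complex.reCLM (η z)) z • fluxX m p q z +
          dy (fun z => Complex.reCLM (η z)) z • fluxY m p q z) +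
        Complex.I * (dx (fun z => Complex.imCLM (η z)) z • fluxX m p q z +
          dy (fun z => Complex.imCLM (η z)) z • fluxY m p q z) := by
      intro z
      simp only [hη.dx_clm_comp, hη.dy_clm_comp]
      simp only [Complex.reCLM_apply, Complex.imCLM_apply, Complex.real_smul]
      conv_lhs => rw [← Complex.re_add_im (dx η z), ← Complex.re_add_im (dy η z)]
      ring
    simp only [e]
    rw [integral_add, integral_const_mul, h1, h2]
    · simp
    · refine i1.congr (Eventually.of_forall fun z => ?_)
      simp only [Pi.add_apply, hη.dx_clm_comp, hη.dy_clm_comp]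
      simp
    · refine i2.congr (Eventually.of_forall fun z => ?_)
      simp only [Pi.add_apply, hη.dx_clm_comp, hη.dy_clm_comp]
      simp
  · intro h η hη
    rw [← h.div _ (hη.clm_comp Complex.ofRealCLM)]
    simp only [hη.dx_clm_comp, hη.dy_clm_comp]
    simp

end Flux

/-! ### Conformality, and the algebra of the coefficient matrix -/

section Conformality

variable {Ω : Set ℂ} {m f p q : ℂ → ℂ} {k : ℝ}

lemma _root_.DifferentiableOn.contDiffOn_real {F : ℂ → ℂ} {V : Set ℂ} (hV : IsOpen V)
    (hF : DifferentiableOn ℂ F V) : ContDiffOn ℝ ∞ F V :=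
  (hF.contDiffOn (n := ∞) hV).restrict_scalars ℝ

lemma _root_.DifferentiableAt.fderiv_real_apply {F : ℂ → ℂ} {w : ℂ} (hF : DifferentiableAt ℂ F w)
    (v : ℂ) : fderiv ℝ F w v = deriv F w * v := by
  rw [(hF.hasDerivAt.hasFDerivAt.restrictScalars ℝ).fderiv]
  simp [mul_comm]

/-- If both `f` and `F ∘ f` solve the generalized Laplace equation, `F` being holomorphic, then
`F''(f) (A ∇f · ∇f) = 0`, the product being complex bilinear. -/
lemma ae_deriv_deriv_mul_flux_eq_zero (hΩ : IsOpen Ω)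
    (hm : AEStronglyMeasurable m (volume.restrict Ω)) (hk : k < 1)
    (hmk : ∀ᵐ z ∂volume.restrict Ω, ‖m z‖ ≤ k) (hfc : ContinuousOn f Ω)
    (hf : HasWeakGradient Ω f p q)
    (hdiv : WeakDivFree Ω (fun z => coeffMatrix (m z)) p q)
    {V : Set ℂ} (hV : IsOpen V) {F : ℂ → ℂ} (hF : DifferentiableOn ℂ F V)
    (hfV : Set.MapsTo f Ω V) {p' q' : ℂ → ℂ}
    (hf' : HasWeakGradient Ω (fun z => F (f z)) p' q')
    (hdiv' : WeakDivFree Ω (fun z => coeffMatrix (m z)) p' q') :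
    ∀ᵐ z ∂volume.restrict Ω,
      deriv (deriv F) (f z) * (p z * fluxX m p q z + q z * fluxY m p q z) = 0 := by
  have hP := memL2Loc_fluxX hm hk hmk hf.memLp_x hf.memLp_y
  have hQ := memL2Loc_fluxY hm hk hmk hf.memLp_x hf.memLp_y
  have hP' := memL2Loc_fluxX hm hk hmk hf'.memLp_x hf'.memLp_y
  have hQ' := memL2Loc_fluxY hm hk hmk hf'.memLp_x hf'.memLp_y
  have hPQ := (weakDivFree_iff_isDivFree hP hQ).1 hdiv
  have hPQ' := (weakDivFree_iff_isDivFree hP' hQ').1 hdiv'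
  have hdF : DifferentiableOn ℂ (deriv F) V := hF.deriv hV
  have hd2F : DifferentiableOn ℂ (deriv (deriv F)) V := hdF.deriv hV
  obtain ⟨hpp, hqq⟩ := hf'.ae_eq hΩ (hf.comp hΩ hfc hV (hF.contDiffOn_real hV) hfV)
  have hflux : ∀ᵐ z ∂volume.restrict Ω,
      fluxX m p' q' z = deriv F (f z) * fluxX m p q z ∧
      fluxY m p' q' z = deriv F (f z) * fluxY m p q z := by
    filter_upwards [hpp, hqq, ae_restrict_mem hΩ.measurableSet] with z h1 h2 hz
    have hd := hF.differentiableAt (hV.mem_nhds (hfV hz))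
    rw [hd.fderiv_real_apply] at h1 h2
    simp only [fluxX, fluxY, h1, h2]
    constructor <;> ring
  have hd2c : ContinuousOn (fun z => deriv (deriv F) (f z)) Ω := hd2F.continuousOn.comp hfc hfV
  have hd1c : ContinuousOn (fun z => deriv F (f z)) Ω := hdF.continuousOn.comp hfc hfV
  have hp2 : MemL2Loc Ω fun z => deriv (deriv F) (f z) * p z := MemL2Loc.mul hd2c hf.memLp_x
  have hq2 : MemL2Loc Ω fun z => deriv (deriv F) (f z) * q z := MemL2Loc.mul hd2c hf.memLp_y
  have hP1 : MemL2Loc Ω fun z => deriv F (f z) * fluxX m p q z := MemL2Loc.mul hd1c hP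
  have hQ1 : MemL2Loc Ω fun z => deriv F (f z) * fluxY m p q z := MemL2Loc.mul hd1c hQ
  have hzero : ∀ η : ℂ → ℂ, IsTest Ω η → ∫ z, η z *
      ((deriv (deriv F) (f z) * p z) * fluxX m p q z +
        (deriv (deriv F) (f z) * q z) * fluxY m p q z) = 0 := by
    intro η hη
    have h1 := hPQ.integral_comp_mul_eq_zero hΩ hfc hf hV (hdF.contDiffOn_real hV) hfV hη
    have h2 := hPQ'.div η hη
    have h3 : ∫ z, (dx η z * fluxX m p' q' z + dy η z * fluxY m p' q' z) =
        ∫ z, (dx η z * (deriv F (f z) * fluxX m p q z) +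
          dy η z * (deriv F (f z) * fluxY m p q z)) := by
      refine integral_congr_ae ?_
      filter_upwards [(ae_restrict_iff' hΩ.measurableSet).1 hflux] with z hz
      by_cases hzη : z ∈ tsupport η
      · obtain ⟨e1, e2⟩ := hz (hη.support hzη)
        rw [e1, e2]
      · simp [dx_of_notMem_tsupport hzη, dy_of_notMem_tsupport hzη]
    have i1 := (hη.dx.integrable_mul hP1).add (hη.dy.integrable_mul hQ1)
    rw [← sub_eq_zero.2 (h1.trans (h2.symm.trans h3)), ← integral_sub]
    · refine integral_congr_ae (Eventually.of_forall fun z => ?_)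
      by_cases hzη : z ∈ tsupport η
      · have hd := hdF.differentiableAt (hV.mem_nhds (hfV (hη.support hzη)))
        simp only [hd.fderiv_real_apply]
        ring
      · simp [dx_of_notMem_tsupport hzη, dy_of_notMem_tsupport hzη,
          image_eq_zero_of_notMem_tsupport hzη]
    · have i2 := (hη.integrable_mul_mul hp2 hP).add (hη.integrable_mul_mul hq2 hQ)
      refine (i1.add i2).congr (Eventually.of_forall fun z => ?_)
      by_cases hzη : z ∈ tsupport η
      · have hd := hdF.differentiableAt (hV.mem_nhds (hfV (hη.support hzη)))
        simp only [Pi.add_apply, hd.fderiv_real_apply]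
        ring
      · simp [dx_of_notMem_tsupport hzη, dy_of_notMem_tsupport hzη,
          image_eq_zero_of_notMem_tsupport hzη]
    · exact i1
  have hloc : LocallyIntegrableOn (fun z => (deriv (deriv F) (f z) * p z) * fluxX m p q z +
      (deriv (deriv F) (f z) * q z) * fluxY m p q z) Ω volume := by
    rw [locallyIntegrableOn_iff hΩ.isLocallyClosed]
    intro K hKΩ hK
    exact ((hp2 K hK hKΩ).integrable_mul (hP K hK hKΩ)).add
      ((hq2 K hK hKΩ).integrable_mul (hQ K hK hKΩ))
  have hae := hΩ.ae_eq_zero_of_integral_contDiff_smul_eq_zero hloc fun η h1 h2 h3 => by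
    have hη : IsTest Ω η := ⟨h1, h2, h3⟩
    simpa [mul_add] using hzero _ (hη.clm_comp Complex.ofRealCLM)
  rw [ae_restrict_iff' hΩ.measurableSet]
  filter_upwards [hae] with z hz hzΩ
  rw [← hz hzΩ]
  ring


end Conformality

section Algebra

variable {m : ℂ}

lemma one_sub_mul_conj (m : ℂ) :
    ((1 - m.re ^ 2 - m.im ^ 2 : ℝ) : ℂ) = 1 - m * conj m := by
  rw [Complex.mul_conj, Complex.normSq_apply]
  push_cast
  ring

lemma one_sub_mul_conj_ne_zero (hm : ‖m‖ < 1) : 1 - m * conj m ≠ 0 := by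
  rw [← one_sub_mul_conj]
  exact_mod_cast (one_sub_sq_pos hm).ne'

lemma coeffMatrix_zero_zero (m : ℂ) :
    (coeffMatrix m 0 0 : ℂ) = (1 - m) * (1 - conj m) / (1 - m * conj m) := by
  rw [← one_sub_mul_conj]
  simp only [coeffMatrix, Matrix.of_apply, Matrix.cons_val', Matrix.cons_val_zero,
    Matrix.cons_val_fin_one]
  rw [Complex.ofReal_div]
  congr 1
  apply Complex.ext <;> simp [pow_two] <;> ring

lemma coeffMatrix_zero_one (m : ℂ) :
    (coeffMatrix m 0 1 : ℂ) = Complex.I * (m - conj m) / (1 - m * conj m) := by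
  rw [← one_sub_mul_conj]
  simp only [coeffMatrix, Matrix.of_apply, Matrix.cons_val', Matrix.cons_val_zero,
    Matrix.cons_val_one, Matrix.cons_val_fin_one]
  rw [Complex.ofReal_div]
  congr 1
  apply Complex.ext
  · simp
    ring
  · simp

lemma coeffMatrix_one_zero (m : ℂ) : coeffMatrix m 1 0 = coeffMatrix m 0 1 := rfl

lemma coeffMatrix_one_one (m : ℂ) :
    (coeffMatrix m 1 1 : ℂ) = (1 + m) * (1 + conj m) / (1 - m * conj m) := by
  rw [← one_sub_mul_conj]
  simp only [coeffMatrix, Matrix.of_apply, Matrix.cons_val', Matrix.cons_val_one,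
    Matrix.cons_val_fin_one]
  rw [Complex.ofReal_div]
  congr 1
  apply Complex.ext
  · simp [pow_two]
  · simp [pow_two]
    ring

/-- The quadratic form of the coefficient matrix, extended complex bilinearly, is up to a factor
the product of the Beltrami operators of `h` and of `h̄`. -/
lemma mul_fluxX_add_mul_fluxY {μ p q : ℂ → ℂ} {z : ℂ} (hm : ‖μ z‖ < 1) :
    p z * fluxX μ p q z + q z * fluxY μ p q z =
      4 / (1 - μ z * conj (μ z)) *
        ((p z + Complex.I * q z) / 2 - μ z * ((p z - Complex.I * q z) / 2)) *
        ((p z - Complex.I * q z) / 2 - conj (μ z) * ((p z + Complex.I * q z) / 2)) := by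
  have h0 := one_sub_mul_conj_ne_zero hm
  simp only [fluxX, fluxY, coeffMatrix_zero_zero, coeffMatrix_zero_one, coeffMatrix_one_zero,
    coeffMatrix_one_one]
  field_simp
  ring_nf
  simp only [Complex.I_sq]
  ring

/-- For solutions of the Beltrami equation, `A ∇u = (v_y, -v_x)` and `A ∇v = (-u_y, u_x)`. -/
lemma flux_of_beltrami {μ p q : ℂ → ℂ} {z : ℂ} (hm : ‖μ z‖ < 1)
    (h : (p z + Complex.I * q z) / 2 = μ z * ((p z - Complex.I * q z) / 2)) :
    fluxX μ p q z = -Complex.I * q z ∧ fluxY μ p q z = Complex.I * p z := by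
  have h0 := one_sub_mul_conj_ne_zero hm
  set a := (p z - Complex.I * q z) / 2 with ha
  have hp : p z = (1 + μ z) * a := by linear_combination h - ha
  have hq : q z = Complex.I * (1 - μ z) * a := by
    linear_combination -Complex.I * h - Complex.I * ha + q z * Complex.I_sq
  simp only [fluxX, fluxY, coeffMatrix_zero_zero, coeffMatrix_zero_one, coeffMatrix_one_zero,
    coeffMatrix_one_one]
  rw [hp, hq]
  constructor
  · field_simp
    ring_nf
    simp only [Complex.I_sq]
    ring
  · field_simp
    ring

lemma jacobian_eq (a b : ℂ) : a.re * b.im - b.re * a.im =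
    ‖(a - Complex.I * b) / 2‖ ^ 2 - ‖(a + Complex.I * b) / 2‖ ^ 2 := by
  rw [Complex.sq_norm, Complex.sq_norm, Complex.normSq_apply, Complex.normSq_apply]
  simp
  ring

lemma jacobian_nonneg_of_beltrami {m a b : ℂ} (hm : ‖m‖ < 1)
    (h : (a + Complex.I * b) / 2 = m * ((a - Complex.I * b) / 2)) :
    0 ≤ a.re * b.im - b.re * a.im := by
  rw [jacobian_eq, h, norm_mul, mul_pow]
  have h1 : ‖m‖ ^ 2 ≤ 1 := pow_le_one₀ (norm_nonneg m) hm.le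
  nlinarith [sq_nonneg ‖(a - Complex.I * b) / 2‖]

lemma beltrami_of_jacobian_nonneg {μ p q : ℂ → ℂ} {z : ℂ} (hm : ‖μ z‖ < 1)
    (h : p z * fluxX μ p q z + q z * fluxY μ p q z = 0)
    (hJ : 0 ≤ (p z).re * (q z).im - (q z).re * (p z).im) :
    (p z + Complex.I * q z) / 2 = μ z * ((p z - Complex.I * q z) / 2) := by
  have h0 := one_sub_mul_conj_ne_zero hm
  rw [mul_fluxX_add_mul_fluxY hm, mul_assoc, mul_eq_zero, mul_eq_zero, sub_eq_zero,
    sub_eq_zero] at h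
  rw [jacobian_eq] at hJ
  set a := (p z - Complex.I * q z) / 2
  set b := (p z + Complex.I * q z) / 2
  rcases h with h | h | h
  · simp [h0] at h
  · exact h
  · have h1 : ‖a‖ = ‖μ z‖ * ‖b‖ := by rw [h, norm_mul, RCLike.norm_conj]
    -- The orientation forces both Wirtinger derivatives to vanish.
    have hb : b = 0 := by
      by_contra hb
      have hb' : 0 < ‖b‖ := norm_pos_iff.2 hb
      have h2 : ‖a‖ < ‖b‖ := by rw [h1]; nlinarith
      nlinarith [norm_nonneg a]
    have ha : a = 0 := by rw [h, hb, mul_zero]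
    rw [hb, ha, mul_zero]

end Algebra

section Charts

/-- The inversion `w ↦ 1 / (w - c)`. -/
def inversion (c : ℂ) : OpenPartialHomeomorph ℂ ℂ where
  toFun w := (w - c)⁻¹
  invFun w := w⁻¹ + c
  source := {c}ᶜ
  target := {0}ᶜ
  map_source' w hw := by simpa [sub_eq_zero] using hw
  map_target' w hw := by simpa using hw
  left_inv' w _ := by simp
  right_inv' w _ := by simp
  open_source := isOpen_compl_singleton
  open_target := isOpen_compl_singleton
  continuousOn_toFun := (continuousOn_id.sub continuousOn_const).inv₀ fun w hw => by
    simpa [sub_eq_zero] using hw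
  continuousOn_invFun := (continuousOn_id.inv₀ fun w hw => by simpa using hw).add continuousOn_const

lemma inversion_mem_groupoid (c : ℂ) : inversion c ∈ contDiffGroupoid ω 𝓘(ℂ) := by
  rw [contDiffGroupoid, mem_groupoid_of_pregroupoid]
  constructor
  · have : ContDiffOn ℂ ω (inversion c) (inversion c).source :=
      (contDiffOn_id.sub contDiffOn_const).inv fun w hw => sub_ne_zero.2 fun h => hw h
    simpa [contDiffPregroupoid, Function.comp_def] using this
  · have : ContDiffOn ℂ ω (inversion c).symm (inversion c).target :=
      (contDiffOn_id.inv fun w (hw : w ≠ 0) => hw).add contDiffOn_const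
    simpa [contDiffPregroupoid, Function.comp_def] using this

lemma trans_inversion_mem_charts {T : Type*} [TopologicalSpace T] [ChartedSpace ℂ T]
    {ψ : OpenPartialHomeomorph T ℂ} (hψ : ψ ∈ Charts T) (c : ℂ) :
    ψ.trans (inversion c) ∈ Charts T := by
  intro e he
  obtain ⟨h1, h2⟩ := hψ e he
  constructor
  · rw [OpenPartialHomeomorph.trans_symm_eq_symm_trans_symm, OpenPartialHomeomorph.trans_assoc]
    exact (contDiffGroupoid ω 𝓘(ℂ)).trans
      ((contDiffGroupoid ω 𝓘(ℂ)).symm (inversion_mem_groupoid c)) h1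
  · rw [← OpenPartialHomeomorph.trans_assoc]
    exact (contDiffGroupoid ω 𝓘(ℂ)).trans h2 (inversion_mem_groupoid c)

lemma deriv_deriv_inversion {c w : ℂ} (hw : w ≠ c) :
    deriv (deriv fun w : ℂ => (w - c)⁻¹) w ≠ 0 := by
  have h1 : ∀ v : ℂ, deriv (fun w : ℂ => (w - c)⁻¹) v = deriv (fun w : ℂ => w⁻¹) (v - c) :=
    fun v => deriv_comp_sub_const (fun w : ℂ => w⁻¹) c v
  have hw' : w - c ≠ 0 := sub_ne_zero.2 hw
  have h2 : deriv (fun w : ℂ => (w - c)⁻¹) = fun v => -((v - c) ^ 2)⁻¹ := by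
    ext v
    rw [h1]
    simp
  have h3 : HasDerivAt (fun v : ℂ => -((v - c) ^ 2)⁻¹)
      (-(-(2 * (w - c)) / ((w - c) ^ 2) ^ 2)) w := by
    refine ((((hasDerivAt_id w).sub_const c).pow 2).inv (pow_ne_zero 2 hw')).neg.congr_deriv ?_
    simp
  rw [h2, h3.deriv]
  field_simp
  simp [hw']

end Charts

/-! ### The Beltrami equation and the Laplace equation of the distorted metric -/

section Local

variable {S T : Type*} [TopologicalSpace S] [TopologicalSpace T] {h : S → T}
  {φ : OpenPartialHomeomorph S ℂ} {ψ : OpenPartialHomeomorph T ℂ}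

lemma isOpen_locDomain (hc : Continuous h) (φ : OpenPartialHomeomorph S ℂ)
    (ψ : OpenPartialHomeomorph T ℂ) : IsOpen (locDomain h φ ψ) :=
  φ.symm.isOpen_inter_preimage (ψ.open_source.preimage hc)

lemma continuousOn_loc (hc : Continuous h) (φ : OpenPartialHomeomorph S ℂ)
    (ψ : OpenPartialHomeomorph T ℂ) : ContinuousOn (loc h φ ψ) (locDomain h φ ψ) :=
  ψ.continuousOn.comp (hc.comp_continuousOn (φ.continuousOn_symm.mono Set.inter_subset_left))
    fun _ hz => hz.2

lemma locDomain_subset_target : locDomain h φ ψ ⊆ φ.target := Set.inter_subset_left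

lemma mapsTo_loc : Set.MapsTo (loc h φ ψ) (locDomain h φ ψ) ψ.target :=
  fun _ hz => ψ.map_source hz.2

lemma BeltramiDifferential.exists_bound [ChartedSpace ℂ S] (μ : BeltramiDifferential S)
    (hφ : φ ∈ Charts S)
    {Ω : Set ℂ} (hΩ : Ω ⊆ φ.target) :
    AEStronglyMeasurable (μ.coeff φ) (volume.restrict Ω) ∧
      ∃ k : ℝ, k < 1 ∧ ∀ᵐ z ∂volume.restrict Ω, ‖μ.coeff φ z‖ ≤ k := by
  obtain ⟨k, hk, hb⟩ := μ.bound
  have hle : volume.restrict Ω ≤ volume.restrict φ.target := Measure.restrict_mono hΩ le_rfl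
  exact ⟨(μ.measurable φ hφ).mono_measure hle, k, hk, ae_mono hle (hb φ hφ)⟩

end Local

lemma WeakDivFree.mono {Ω Ω' : Set ℂ} {M : ℂ → Matrix (Fin 2) (Fin 2) ℝ} {p q : ℂ → ℂ}
    (h : WeakDivFree Ω M p q) (hs : Ω' ⊆ Ω) : WeakDivFree Ω' M p q :=
  fun η hη => h η (hη.mono hs)

lemma weakDivFree_congr {Ω : Set ℂ} (hΩ : MeasurableSet Ω)
    {M M' : ℂ → Matrix (Fin 2) (Fin 2) ℝ} (h : ∀ᵐ z ∂volume.restrict Ω, M z = M' z)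
    (p q : ℂ → ℂ) : WeakDivFree Ω M p q ↔ WeakDivFree Ω M' p q := by
  have key : ∀ η : ℂ → ℝ, IsTest Ω η → ∀ᵐ z, ∀ v : Fin 2 → ℝ,
      ![dx η z, dy η z] ⬝ᵥ (M z).mulVec v = ![dx η z, dy η z] ⬝ᵥ (M' z).mulVec v := by
    intro η hη
    filter_upwards [(ae_restrict_iff' hΩ).1 h] with z hz v
    by_cases hzη : z ∈ tsupport η
    · rw [hz (hη.support hzη)]
    · simp [dx_of_notMem_tsupport hzη, dy_of_notMem_tsupport hzη, dotProduct, Fin.sum_univ_two]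
  refine forall₂_congr fun η hη => ?_
  rw [integral_congr_ae ((key η hη).mono fun z hz => hz _),
    integral_congr_ae ((key η hη).mono fun z hz => hz _)]

section Distorted

variable {s : ℝ} {m : ℂ}

lemma distortedMatrix_eq (s : ℝ) (m : ℂ) : distortedMatrix s m =
    !![s * ((1 + m.re) ^ 2 + m.im ^ 2), s * (2 * m.im);
      s * (2 * m.im), s * ((m.re - 1) ^ 2 + m.im ^ 2)] := by
  ext i j
  fin_cases i <;> fin_cases j <;> simp [distortedMatrix] <;> exact Or.inl (by ring)

lemma sqrt_det_distortedMatrix (hs : 0 < s) (hm : ‖m‖ < 1) :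
    Real.sqrt (distortedMatrix s m).det = s * (1 - m.re ^ 2 - m.im ^ 2) := by
  have hD := one_sub_sq_pos hm
  rw [distortedMatrix_eq, Matrix.det_fin_two_of]
  rw [show s * ((1 + m.re) ^ 2 + m.im ^ 2) * (s * ((m.re - 1) ^ 2 + m.im ^ 2)) -
    s * (2 * m.im) * (s * (2 * m.im)) = (s * (1 - m.re ^ 2 - m.im ^ 2)) ^ 2 by ring]
  exact Real.sqrt_sq (by positivity)

/-- The Laplace-Beltrami operator of `|dz + μ dz̄|²` is `∇·(A ∇)` up to a factor. -/
lemma sqrt_det_smul_inv_distortedMatrix (hs : 0 < s) (hm : ‖m‖ < 1) :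
    Real.sqrt (distortedMatrix s m).det • (distortedMatrix s m)⁻¹ = coeffMatrix m := by
  have hD := one_sub_sq_pos hm
  have hdet : (distortedMatrix s m).det = (s * (1 - m.re ^ 2 - m.im ^ 2)) ^ 2 := by
    rw [distortedMatrix_eq, Matrix.det_fin_two_of]
    ring
  rw [sqrt_det_distortedMatrix hs hm, Matrix.inv_def, hdet, Ring.inverse_eq_inv',
    distortedMatrix_eq, Matrix.adjugate_fin_two_of]
  ext i j
  fin_cases i <;> fin_cases j <;> simp [coeffMatrix] <;> field_simp

end Distorted

theorem solvesLaplaceIn_iff {S T : Type*} [TopologicalSpace S] [ChartedSpace ℂ S]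
    [TopologicalSpace T] (σ : ConformalMetric S) (μ : BeltramiDifferential S) {h : S → T}
    (hc : Continuous h) (ψ : OpenPartialHomeomorph T ℂ) :
    SolvesLaplaceIn σ μ h ψ ↔ SolvesGenLaplaceIn μ h ψ := by
  refine forall₂_congr fun φ hφ => exists₂_congr fun p q => and_congr_right fun _ => ?_
  have hΩ := (isOpen_locDomain hc φ ψ).measurableSet
  refine weakDivFree_congr hΩ ?_ p q
  obtain ⟨-, k, hk, hb⟩ := μ.exists_bound hφ (locDomain_subset_target (h := h) (ψ := ψ))
  filter_upwards [hb, ae_restrict_mem hΩ] with z hz hzΩ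
  exact sqrt_det_smul_inv_distortedMatrix (σ.pos φ hφ z (locDomain_subset_target hzΩ))
    (hz.trans_lt hk)

section Main

variable {S T : Type*} [TopologicalSpace S] [ChartedSpace ℂ S]
  [TopologicalSpace T] [ChartedSpace ℂ T]

/-- A map that solves the generalized Laplace equation in *every* conformal coordinate of the
target is `μ`-conformal: `A ∇h · ∇h = 0`. The coordinates `w`, `1 / w` and `1 / (w - 1)` suffice,
as the inversions have nonvanishing second derivative and their domains cover the plane. -/
theorem SolvesGenLaplace.ae_mul_flux_eq_zero {μ : BeltramiDifferential S} {h : S → T}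
    (hh : SolvesGenLaplace μ h) (hc : Continuous h) {φ : OpenPartialHomeomorph S ℂ}
    (hφ : φ ∈ Charts S) {ψ : OpenPartialHomeomorph T ℂ} (hψ : ψ ∈ Charts T) {p q : ℂ → ℂ}
    (hg : HasWeakGradient (locDomain h φ ψ) (loc h φ ψ) p q)
    (hd : WeakDivFree (locDomain h φ ψ) (fun z => coeffMatrix (μ.coeff φ z)) p q) :
    ∀ᵐ z ∂volume.restrict (locDomain h φ ψ),
      p z * fluxX (μ.coeff φ) p q z + q z * fluxY (μ.coeff φ) p q z = 0 := by
  have hΩ := isOpen_locDomain hc φ ψ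
  have key : ∀ c : ℂ, ∀ᵐ z ∂volume.restrict (locDomain h φ ψ), loc h φ ψ z ≠ c →
      p z * fluxX (μ.coeff φ) p q z + q z * fluxY (μ.coeff φ) p q z = 0 := by
    intro c
    have hs : locDomain h φ (ψ.trans (inversion c)) ⊆ locDomain h φ ψ :=
      fun z hz => ⟨hz.1, hz.2.1⟩
    have hΩc := isOpen_locDomain hc φ (ψ.trans (inversion c))
    obtain ⟨hm, k, hk, hb⟩ := μ.exists_bound hφ
      (locDomain_subset_target (h := h) (ψ := ψ.trans (inversion c)))
    obtain ⟨p', q', hg', hd'⟩ := hh _ (trans_inversion_mem_charts hψ c) φ hφ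
    have hmaps : Set.MapsTo (loc h φ ψ) (locDomain h φ (ψ.trans (inversion c))) {c}ᶜ :=
      fun z hz => hz.2.2
    have hF : DifferentiableOn ℂ (fun w : ℂ => (w - c)⁻¹) {c}ᶜ := fun w hw =>
      ((differentiableAt_id.sub_const c).inv (sub_ne_zero.2 hw)).differentiableWithinAt
    have h0 := ae_deriv_deriv_mul_flux_eq_zero hΩc hm hk hb ((continuousOn_loc hc φ ψ).mono hs)
      (hg.mono hs) (hd.mono hs) isOpen_compl_singleton hF hmaps hg' hd'
    rw [ae_restrict_iff' hΩ.measurableSet]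
    filter_upwards [(ae_restrict_iff' hΩc.measurableSet).1 h0] with z hz hzΩ hzc
    exact (mul_eq_zero.1 (hz ⟨hzΩ.1, hzΩ.2, hzc⟩)).resolve_left (deriv_deriv_inversion hzc)
  filter_upwards [key 0, key 1] with z h0 h1
  by_cases hz : loc h φ ψ z = 0
  · exact h1 (by simp [hz])
  · exact h0 hz

theorem SolvesBeltrami.solvesGenLaplace {μ : BeltramiDifferential S} {h : S → T}
    (hh : SolvesBeltrami μ h) (hc : Continuous h) : SolvesGenLaplace μ h := by
  intro ψ hψ φ hφ
  obtain ⟨p, q, hg, hb⟩ := hh φ hφ ψ hψ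
  refine ⟨p, q, hg, ?_⟩
  have hΩ := (isOpen_locDomain hc φ ψ).measurableSet
  obtain ⟨hm, k, hk, hmk⟩ := μ.exists_bound hφ (locDomain_subset_target (h := h) (ψ := ψ))
  rw [weakDivFree_iff_real (memL2Loc_fluxX hm hk hmk hg.memLp_x hg.memLp_y)
    (memL2Loc_fluxY hm hk hmk hg.memLp_x hg.memLp_y)]
  intro η hη
  have hηc := hη.clm_comp Complex.ofRealCLM
  have i1 : Integrable fun z => dx η z • q z := by
    refine (hηc.dx.integrable_mul hg.memLp_y).congr (Eventually.of_forall fun z => ?_)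
    simp only [hη.dx_clm_comp]
    simp
  have i2 : Integrable fun z => dy η z • p z := by
    refine (hηc.dy.integrable_mul hg.memLp_x).congr (Eventually.of_forall fun z => ?_)
    simp only [hη.dy_clm_comp]
    simp
  have e : ∫ z, (dx η z • fluxX (μ.coeff φ) p q z + dy η z • fluxY (μ.coeff φ) p q z) =
      ∫ z, Complex.I * (dy η z • p z - dx η z • q z) := by
    refine integral_congr_ae ?_
    filter_upwards [(ae_restrict_iff' hΩ).1 hb, (ae_restrict_iff' hΩ).1 hmk] with z h1 h2
    by_cases hzη : z ∈ tsupport η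
    · obtain ⟨e1, e2⟩ := flux_of_beltrami ((h2 (hη.support hzη)).trans_lt hk)
        (h1 (hη.support hzη))
      rw [e1, e2]
      simp only [Complex.real_smul]
      ring
    · simp [dx_of_notMem_tsupport hzη, dy_of_notMem_tsupport hzη]
  rw [e, integral_const_mul, integral_sub i2 i1, hg.integral_dx_smul_eq_integral_dy_smul η hη,
    sub_self, mul_zero]

theorem SolvesBeltrami.jacobianNonneg {μ : BeltramiDifferential S} {h : S → T}
    (hh : SolvesBeltrami μ h) : JacobianNonneg h := by
  intro φ hφ ψ hψ
  obtain ⟨p, q, hg, hb⟩ := hh φ hφ ψ hψ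
  refine ⟨p, q, hg, ?_⟩
  obtain ⟨-, k, hk, hmk⟩ := μ.exists_bound hφ (locDomain_subset_target (h := h) (ψ := ψ))
  filter_upwards [hb, hmk] with z h1 h2
  exact jacobian_nonneg_of_beltrami (h2.trans_lt hk) h1

theorem solvesBeltrami_iff {μ : BeltramiDifferential S} {h : S → T} (hc : Continuous h) :
    SolvesBeltrami μ h ↔ SolvesGenLaplace μ h ∧ JacobianNonneg h := by
  refine ⟨fun hh => ⟨hh.solvesGenLaplace hc, hh.jacobianNonneg⟩, fun ⟨hh, hJ⟩ φ hφ ψ hψ => ?_⟩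
  obtain ⟨p, q, hg, hd⟩ := hh ψ hψ φ hφ
  obtain ⟨p', q', hg', hJ'⟩ := hJ φ hφ ψ hψ
  obtain ⟨hpp, hqq⟩ := hg.ae_eq (isOpen_locDomain hc φ ψ) hg'
  obtain ⟨-, k, hk, hmk⟩ := μ.exists_bound hφ (locDomain_subset_target (h := h) (ψ := ψ))
  refine ⟨p, q, hg, ?_⟩
  filter_upwards [hh.ae_mul_flux_eq_zero hc hφ hψ hg hd, hJ', hpp, hqq, hmk] with z h1 h2 h3 h4 h5
  rw [← h3, ← h4] at h2
  exact beltrami_of_jacobian_nonneg (h5.trans_lt hk) h1 h2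

end Main

/-! ### The first variation of the energy -/

section FirstVariation

/-- Differentiation under the integral sign for an energy whose density is a quadratic polynomial
in the variation parameter `t`, weighted by a smooth function of `f + t η`. -/
lemma hasDerivAt_integral_mul_quadratic {K V : Set ℂ} (hK : IsCompact K) (hV : IsOpen V)
    {r : ℂ → ℝ} (hr : ContDiffOn ℝ ∞ r V) {f η : ℂ → ℂ} (hf : ContinuousOn f K)
    (hfV : Set.MapsTo f K V) (hη : ContinuousOn η K) {e₀ e₁ e₂ : ℂ → ℝ}
    (h₀ : IntegrableOn e₀ K) (h₁ : IntegrableOn e₁ K) (h₂ : IntegrableOn e₂ K) :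
    HasDerivAt (fun t : ℝ => ∫ z in K, r (f z + t * η z) * (e₀ z + t * e₁ z + t ^ 2 * e₂ z))
      (∫ z in K, (fderiv ℝ r (f z) (η z) * e₀ z + r (f z) * e₁ z)) 0 := by
  have hfK : IsCompact (f '' K) := hK.image_of_continuousOn hf
  obtain ⟨R, hR, hRc, hRr⟩ := exists_contDiff_eventuallyEq_of_isCompact hV hr hfK
    (Set.image_subset_iff.2 hfV)
  have hRd : Continuous (fderiv ℝ R) := hR.continuous_fderiv (by simp)
  obtain ⟨C₀, hC₀⟩ := hR.continuous.bounded_above_of_compact_support hRc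
  obtain ⟨C₁, hC₁⟩ := hRd.bounded_above_of_compact_support (hRc.fderiv ℝ)
  obtain ⟨C₂, hC₂⟩ := hK.exists_bound_of_continuousOn hη
  -- Near `t = 0` the values `f + t η` stay where `r` agrees with its globally smooth extension.
  have hev : ∀ᶠ t : ℝ in 𝓝 0, ∀ z ∈ K, R (f z + t * η z) = r (f z + t * η z) := by
    obtain ⟨δ, hδ, hsub⟩ := hfK.exists_thickening_subset_open isOpen_interior
      (t := interior {w | R w = r w}) fun w hw => mem_interior_iff_mem_nhds.2 (hRr w hw)
    have hlim : Tendsto (fun t : ℝ => |t| * (|C₂| + 1)) (𝓝 0) (𝓝 0) := by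
      have : Continuous fun t : ℝ => |t| * (|C₂| + 1) := by fun_prop
      simpa using this.tendsto 0
    filter_upwards [hlim.eventually (gt_mem_nhds hδ)] with t ht z hz
    have hmem : f z + t * η z ∈ thickening δ (f '' K) := by
      rw [mem_thickening_iff]
      refine ⟨f z, ⟨z, hz, rfl⟩, lt_of_le_of_lt ?_ ht⟩
      rw [dist_eq_norm, add_sub_cancel_left, norm_mul, Complex.norm_real, Real.norm_eq_abs]
      gcongr
      exact (hC₂ z hz).trans ((le_abs_self _).trans (by linarith))
    have hw := interior_subset (hsub hmem)
    exact hw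
  have hmeas : ∀ t : ℝ, ContinuousOn (fun z => f z + t * η z) K := fun t =>
    hf.add (continuousOn_const.mul hη)
  have hquad : ∀ t : ℝ, IntegrableOn (fun z => e₀ z + t * e₁ z + t ^ 2 * e₂ z) K := fun t =>
    (h₀.add (h₁.const_mul t)).add (h₂.const_mul (t ^ 2))
  have hRm : ∀ t : ℝ, AEStronglyMeasurable (fun z => R (f z + t * η z)) (volume.restrict K) :=
    fun t => (hR.continuous.comp_continuousOn (hmeas t)).aestronglyMeasurable_of_isCompact hK
      hK.measurableSet
  have hint : ∀ t : ℝ, IntegrableOn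
      (fun z => R (f z + t * η z) * (e₀ z + t * e₁ z + t ^ 2 * e₂ z)) K := fun t =>
    (hquad t).bdd_mul (hRm t) (Eventually.of_forall fun z => hC₀ _)
  have hDm : AEStronglyMeasurable (fun z => fderiv ℝ R (f z) (η z)) (volume.restrict K) :=
    ((hRd.comp_continuousOn hf).clm_apply hη).aestronglyMeasurable_of_isCompact hK
      hK.measurableSet
  have hmain := (hasDerivAt_integral_of_dominated_loc_of_deriv_le (μ := volume.restrict K)
    (𝕜 := ℝ) (x₀ := (0 : ℝ)) (s := ball 0 1) (ball_mem_nhds 0 one_pos)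
    (F := fun (t : ℝ) z => R (f z + t * η z) * (e₀ z + t * e₁ z + t ^ 2 * e₂ z))
    (F' := fun (t : ℝ) z => fderiv ℝ R (f z + t * η z) (η z) * (e₀ z + t * e₁ z + t ^ 2 * e₂ z) +
      R (f z + t * η z) * (e₁ z + 2 * t * e₂ z))
    (bound := fun z => C₁ * C₂ * (‖e₀ z‖ + ‖e₁ z‖ + ‖e₂ z‖) + C₀ * (‖e₁ z‖ + 2 * ‖e₂ z‖))
    (Eventually.of_forall fun t => (hint t).1) (hint 0) ?_ ?_ ?_ ?_).2
  · refine (hmain.congr_deriv ?_).congr_of_eventuallyEq ?_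
    · refine setIntegral_congr_fun hK.measurableSet fun z hz => ?_
      have h1 := hRr (f z) ⟨z, hz, rfl⟩
      simp [h1.fderiv_eq, h1.eq_of_nhds]
    · filter_upwards [hev] with t ht
      refine setIntegral_congr_fun hK.measurableSet fun z hz => ?_
      simp only [ht z hz]
  · simp only [Complex.ofReal_zero, zero_mul, add_zero, mul_zero, ne_eq, OfNat.ofNat_ne_zero,
      not_false_eq_true, zero_pow]
    refine (hDm.mul h₀.1).add (AEStronglyMeasurable.mul ?_ h₁.1)
    simpa using hRm 0
  · refine (ae_restrict_iff' hK.measurableSet).2 (Eventually.of_forall fun z hz t ht => ?_)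
    have ht1 : |t| ≤ 1 := by
      have := mem_ball_zero_iff.1 ht
      exact this.le
    have ht2 : t ^ 2 ≤ 1 := by
      rw [← sq_abs]
      exact pow_le_one₀ (abs_nonneg t) ht1
    have hCz := hC₂ z hz
    have b1 : ‖fderiv ℝ R (f z + t * η z) (η z)‖ ≤ C₁ * C₂ :=
      ((fderiv ℝ R (f z + t * η z)).le_of_opNorm_le (hC₁ _) _).trans
        (mul_le_mul_of_nonneg_left hCz ((norm_nonneg _).trans (hC₁ 0)))
    have b2 : ‖e₀ z + t * e₁ z + t ^ 2 * e₂ z‖ ≤ ‖e₀ z‖ + ‖e₁ z‖ + ‖e₂ z‖ := by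
      refine (norm_add₃_le).trans ?_
      rw [norm_mul, norm_mul, Real.norm_eq_abs t, Real.norm_of_nonneg (sq_nonneg t)]
      gcongr
      · exact mul_le_of_le_one_left (norm_nonneg _) ht1
      · exact mul_le_of_le_one_left (norm_nonneg _) ht2
    have b3 : ‖e₁ z + 2 * t * e₂ z‖ ≤ ‖e₁ z‖ + 2 * ‖e₂ z‖ := by
      refine (norm_add_le _ _).trans ?_
      rw [norm_mul, norm_mul, Real.norm_eq_abs t, Real.norm_of_nonneg (zero_le_two)]
      gcongr
      linarith
    refine (norm_add_le _ _).trans ?_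
    rw [norm_mul, norm_mul]
    exact add_le_add (mul_le_mul b1 b2 (norm_nonneg _) ((norm_nonneg _).trans b1))
      (mul_le_mul (hC₀ _) b3 (norm_nonneg _) ((norm_nonneg _).trans (hC₀ 0)))
  · exact (((h₀.norm.add h₁.norm).add h₂.norm).const_mul _).add
      ((h₁.norm.add (h₂.norm.const_mul 2)).const_mul _)
  · refine Eventually.of_forall fun z t _ => ?_
    have d1 : HasDerivAt (fun t : ℝ => f z + t * η z) (η z) t := by
      simpa using ((Complex.ofRealCLM.hasDerivAt (x := t)).mul_const (η z)).const_add (f z)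
    have d2 := ((hR.contDiffAt (x := f z + t * η z)).differentiableAt
      (by simp)).hasFDerivAt.comp_hasDerivAt t d1
    have d3 : HasDerivAt (fun t : ℝ => e₀ z + t * e₁ z + t ^ 2 * e₂ z)
        (e₁ z + 2 * t * e₂ z) t := by
      have := (((hasDerivAt_id t).mul_const (e₁ z)).const_add (e₀ z)).add
        (((hasDerivAt_id t).pow 2).mul_const (e₂ z))
      refine this.congr_deriv ?_
      simp
    exact d2.mul d3

/-- The energy density of a map with partial derivatives `a`, `b` for the flat metric on the
target, `tr(A ∇h ∇h̄)`. -/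
def quadEnergy (m a b : ℂ) : ℝ :=
  coeffMatrix m 0 0 * (a * conj a).re + 2 * coeffMatrix m 0 1 * (a * conj b).re +
    coeffMatrix m 1 1 * (b * conj b).re

lemma energyDensity_distortedMatrix {s : ℝ} {m : ℂ} (hs : 0 < s) (hm : ‖m‖ < 1) (r : ℝ)
    (p q : ℂ) : energyDensity (distortedMatrix s m) r p q = r * quadEnergy m p q := by
  have h := sqrt_det_smul_inv_distortedMatrix hs hm
  have he : ∀ i j, coeffMatrix m i j =
      Real.sqrt (distortedMatrix s m).det * (distortedMatrix s m)⁻¹ i j := fun i j => by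
    rw [← h]; rfl
  have hsymm : (q * conj p).re = (p * conj q).re := by
    simp; ring
  have h10 : (distortedMatrix s m)⁻¹ 1 0 * Real.sqrt (distortedMatrix s m).det =
      coeffMatrix m 0 1 := by
    rw [← coeffMatrix_one_zero, he]; ring
  simp only [energyDensity, Fin.sum_univ_two, Matrix.cons_val_zero, Matrix.cons_val_one]
  rw [hsymm, quadEnergy]
  rw [add_mul, add_mul, add_mul]
  rw [show (distortedMatrix s m)⁻¹ 1 0 * (r * (p * conj q).re) *
    Real.sqrt (distortedMatrix s m).det = r * (coeffMatrix m 0 1 * (p * conj q).re) by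
      rw [← h10]; ring]
  rw [he 0 0, he 0 1, he 1 1]
  ring

lemma quadEnergy_eq_re_flux (m p q : ℂ → ℂ) (z : ℂ) :
    quadEnergy (m z) (p z) (q z) =
      (conj (p z) * fluxX m p q z + conj (q z) * fluxY m p q z).re := by
  simp only [quadEnergy, fluxX, fluxY, coeffMatrix_one_zero]
  simp
  ring

lemma im_conj_mul_flux (m p q : ℂ → ℂ) (z : ℂ) :
    (conj (p z) * fluxX m p q z + conj (q z) * fluxY m p q z).im = 0 := by
  simp only [fluxX, fluxY, coeffMatrix_one_zero]
  simp
  ring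

lemma quadEnergy_add_mul (m p q : ℂ → ℂ) (z a b : ℂ) (t : ℝ) :
    quadEnergy (m z) (p z + t * a) (q z + t * b) = quadEnergy (m z) (p z) (q z) +
      t * (2 * (conj a * fluxX m p q z + conj b * fluxY m p q z).re) +
      t ^ 2 * quadEnergy (m z) a b := by
  simp only [quadEnergy, fluxX, fluxY, coeffMatrix_one_zero]
  simp
  ring

variable {S T : Type*} [TopologicalSpace S] [ChartedSpace ℂ S]
  [TopologicalSpace T] [ChartedSpace ℂ T]

/-- The first variation of the Dirichlet energy, in local coordinates. -/
lemma hasDerivAt_energy (σ : ConformalMetric S) (μ : BeltramiDifferential S)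
    (ρ : ConformalMetric T) {h : S → T} (hc : Continuous h) {φ : OpenPartialHomeomorph S ℂ}
    (hφ : φ ∈ Charts S) {ψ : OpenPartialHomeomorph T ℂ} (hψ : ψ ∈ Charts T) {p q : ℂ → ℂ}
    (hp : MemL2Loc (locDomain h φ ψ) p) (hq : MemL2Loc (locDomain h φ ψ) q)
    {K : Set ℂ} (hK : IsCompact K) (hKΩ : K ⊆ locDomain h φ ψ) {η : ℂ → ℂ}
    (hη : IsTest (locDomain h φ ψ) η) (hηK : tsupport η ⊆ K) :
    HasDerivAt (fun t : ℝ => ∫ z in K,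
      energyDensity (distorted σ μ φ z) (ρ.density ψ (loc h φ ψ z + t * η z))
        (p z + t * dx η z) (q z + t * dy η z))
      (∫ z, (fderiv ℝ (ρ.density ψ) (loc h φ ψ z) (η z) *
          (conj (p z) * fluxX (μ.coeff φ) p q z + conj (q z) * fluxY (μ.coeff φ) p q z).re +
        ρ.density ψ (loc h φ ψ z) * (2 * (conj (dx η z) * fluxX (μ.coeff φ) p q z +
          conj (dy η z) * fluxY (μ.coeff φ) p q z).re))) 0 := by
  obtain ⟨hm, k, hk, hmk⟩ := μ.exists_bound hφ (locDomain_subset_target (h := h) (ψ := ψ))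
  have hle : volume.restrict K ≤ volume.restrict (locDomain h φ ψ) :=
    Measure.restrict_mono hKΩ le_rfl
  have hflux : ∀ a b c d : ℂ → ℂ, MemL2Loc (locDomain h φ ψ) a → MemL2Loc (locDomain h φ ψ) b →
      MemL2Loc (locDomain h φ ψ) c → MemL2Loc (locDomain h φ ψ) d →
      IntegrableOn (fun z => (conj (c z) * fluxX (μ.coeff φ) a b z +
        conj (d z) * fluxY (μ.coeff φ) a b z).re) K := by
    intro a b c d ha hb hc' hd
    have hconj : ∀ e : ℂ → ℂ, MemL2Loc (locDomain h φ ψ) e →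
        MemL2Loc (locDomain h φ ψ) fun z => conj (e z) := fun e he =>
      MemL2Loc.clm_apply (c := fun _ => (Complex.conjCLE : ℂ →L[ℝ] ℂ)) continuousOn_const he
    exact (((hconj c hc' K hK hKΩ).integrable_mul (memL2Loc_fluxX hm hk hmk ha hb K hK hKΩ)).add
      ((hconj d hd K hK hKΩ).integrable_mul (memL2Loc_fluxY hm hk hmk ha hb K hK hKΩ))).re
  have hdx : MemL2Loc (locDomain h φ ψ) (dx η) :=
    memL2Loc_of_continuousOn hη.dx.smooth.continuous.continuousOn
  have hdy : MemL2Loc (locDomain h φ ψ) (dy η) :=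
    memL2Loc_of_continuousOn hη.dy.smooth.continuous.continuousOn
  have h0 := hasDerivAt_integral_mul_quadratic hK ψ.open_target (ρ.smooth ψ hψ)
    ((continuousOn_loc hc φ ψ).mono hKΩ) (fun z hz => mapsTo_loc (hKΩ hz))
    (hη.smooth.continuous.continuousOn (s := K))
    (hflux p q p q hp hq hp hq) ((hflux p q _ _ hp hq hdx hdy).const_mul 2)
    (hflux (dx η) (dy η) _ _ hdx hdy hdx hdy)
  have e : ∀ t : ℝ, ∫ z in K, energyDensity (distorted σ μ φ z)
      (ρ.density ψ (loc h φ ψ z + t * η z)) (p z + t * dx η z) (q z + t * dy η z) =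
      ∫ z in K, ρ.density ψ (loc h φ ψ z + t * η z) *
        ((conj (p z) * fluxX (μ.coeff φ) p q z + conj (q z) * fluxY (μ.coeff φ) p q z).re +
        t * (2 * (conj (dx η z) * fluxX (μ.coeff φ) p q z +
          conj (dy η z) * fluxY (μ.coeff φ) p q z).re) +
        t ^ 2 * (conj (dx η z) * fluxX (μ.coeff φ) (dx η) (dy η) z +
          conj (dy η z) * fluxY (μ.coeff φ) (dx η) (dy η) z).re) := by
    intro t
    refine integral_congr_ae ?_
    filter_upwards [ae_mono hle hmk, ae_restrict_mem hK.measurableSet] with z hz hzK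
    rw [distorted, energyDensity_distortedMatrix
      (σ.pos φ hφ z (locDomain_subset_target (hKΩ hzK))) (hz.trans_lt hk), quadEnergy_add_mul,
      quadEnergy_eq_re_flux, quadEnergy_eq_re_flux]
  simp only [e]
  rwa [integral_eq_setIntegral_of_tsupport_subset hηK]
  intro z hz
  simp [image_eq_zero_of_notMem_tsupport hz, dx_of_notMem_tsupport hz, dy_of_notMem_tsupport hz]

end FirstVariation

section Harmonic

/-- For an isotropic gradient, the variation of the density `ρ(h)` and the variation of the
gradient combine: this identity turns the first variation of the energy into a divergence. Here `L`
stands for the derivative of `ρ`, and `(P, Q)` for the flux. -/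
lemma re_conj_mul_eq_of_isotropic {p q P Q : ℂ} (h1 : p * P + q * Q = 0)
    (h2 : (conj p * P + conj q * Q).im = 0) (L : ℂ →L[ℝ] ℝ) (η : ℂ) :
    2 * (conj η * ((L p : ℂ) * P + (L q : ℂ) * Q)).re = L η * (conj p * P + conj q * Q).re := by
  have hL : ∀ v : ℂ, L v = v.re * L 1 + v.im * L Complex.I := by
    intro v
    conv_lhs => rw [show v = v.re • (1 : ℂ) + v.im • Complex.I by simp [Complex.re_add_im]]
    rw [map_add, map_smul, map_smul, smul_eq_mul, smul_eq_mul]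
  have h3 := congrArg Complex.re h1
  have h4 := congrArg Complex.im h1
  rw [hL p, hL q, hL η]
  generalize L 1 = A at *
  generalize L Complex.I = B at *
  simp at h2 h3 h4 ⊢
  linear_combination (η.re * A - η.im * B) * h3 + (η.re * B + η.im * A) * h4
    + (η.im * A - η.re * B) * h2

end Harmonic

/-! ### Harmonicity -/

lemma IsDivFree.integrable_comp_mul {Ω : Set ℂ} {f p q : ℂ → ℂ}
    (hfc : ContinuousOn f Ω) (hf : HasWeakGradient Ω f p q) {P Q : ℂ → ℂ}
    (hPQ : IsDivFree Ω P Q) {V : Set ℂ} (hV : IsOpen V) {Φ : ℂ → ℂ} (hΦ : ContDiffOn ℝ ∞ Φ V)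
    (hfV : Set.MapsTo f Ω V) {η : ℂ → ℂ} (hη : IsTest Ω η) :
    Integrable fun z => Φ (f z) * (dx η z * P z + dy η z * Q z) +
      η z * (fderiv ℝ Φ (f z) (p z) * P z + fderiv ℝ Φ (f z) (q z) * Q z) := by
  have hΦf : ContinuousOn (fun z => Φ (f z)) Ω := hΦ.continuousOn.comp hfc hfV
  have hd := continuousOn_fderiv_comp hfc hV hΦ hfV
  have i1 := (hη.dx.integrable_mul (MemL2Loc.mul hΦf hPQ.memLp_x)).add
    (hη.dy.integrable_mul (MemL2Loc.mul hΦf hPQ.memLp_y))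
  have i2 := (hη.integrable_mul_mul (MemL2Loc.clm_apply hd hf.memLp_x) hPQ.memLp_x).add
    (hη.integrable_mul_mul (MemL2Loc.clm_apply hd hf.memLp_y) hPQ.memLp_y)
  refine (i1.add i2).congr (Eventually.of_forall fun z => ?_)
  simp only [Pi.add_apply]
  ring

section Harmonic

variable {S T : Type*} [TopologicalSpace S] [ChartedSpace ℂ S]
  [TopologicalSpace T] [ChartedSpace ℂ T]

/-- The first variation of the energy is `2 Re ∫ A ∇h · ∇(ρ(h) η̄)`, because of
`A ∇h · ∇h = 0`. -/
theorem SolvesGenLaplace.isHarmonic (σ : ConformalMetric S) {μ : BeltramiDifferential S}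
    (ρ : ConformalMetric T) {h : S → T} (hh : SolvesGenLaplace μ h) (hc : Continuous h) :
    IsHarmonic σ μ ρ h := by
  intro φ hφ ψ hψ
  obtain ⟨p, q, hg, hd⟩ := hh ψ hψ φ hφ
  refine ⟨p, q, hg, fun K hK hKΩ η hη hηK => ?_⟩
  refine (hasDerivAt_energy σ μ ρ hc hφ hψ hg.memLp_x hg.memLp_y hK hKΩ hη hηK).congr_deriv ?_
  have hΩ := isOpen_locDomain hc φ ψ
  obtain ⟨hm, k, hk, hmk⟩ := μ.exists_bound hφ (locDomain_subset_target (h := h) (ψ := ψ))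
  have hPQ := (weakDivFree_iff_isDivFree (memL2Loc_fluxX hm hk hmk hg.memLp_x hg.memLp_y)
    (memL2Loc_fluxY hm hk hmk hg.memLp_x hg.memLp_y)).1 hd
  have hiso := hh.ae_mul_flux_eq_zero hc hφ hψ hg hd
  have hρ : ContDiffOn ℝ ∞ (fun w => (ρ.density ψ w : ℂ)) ψ.target :=
    Complex.ofRealCLM.contDiff.comp_contDiffOn (ρ.smooth ψ hψ)
  have hη' : IsTest (locDomain h φ ψ) fun z => (Complex.conjCLE : ℂ →L[ℝ] ℂ) (η z) :=
    hη.clm_comp _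
  have h0 := hPQ.integral_comp_mul_eq_zero hΩ (continuousOn_loc hc φ ψ) hg ψ.open_target hρ
    mapsTo_loc hη'
  have hi := hPQ.integrable_comp_mul (continuousOn_loc hc φ ψ) hg ψ.open_target hρ
    mapsTo_loc hη'
  have hre := Complex.reCLM.integral_comp_comm hi
  rw [h0, map_zero] at hre
  rw [← mul_zero (2 : ℝ), ← hre, ← integral_const_mul]
  refine integral_congr_ae ?_
  filter_upwards [(ae_restrict_iff' hΩ.measurableSet).1 hiso] with z hz
  by_cases hzη : z ∈ tsupport η
  · have hzΩ := hη.support hzη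
    have hdiff : DifferentiableAt ℝ (ρ.density ψ) (loc h φ ψ z) :=
      ((ρ.smooth ψ hψ).contDiffAt (ψ.open_target.mem_nhds (mapsTo_loc hzΩ))).differentiableAt
        (by simp)
    have hfd : ∀ v, fderiv ℝ (fun w => (ρ.density ψ w : ℂ)) (loc h φ ψ z) v =
        (fderiv ℝ (ρ.density ψ) (loc h φ ψ z) v : ℂ) := fun v => by
      have h1 := (Complex.ofRealCLM.hasFDerivAt.comp _ hdiff.hasFDerivAt).fderiv
      have h2 : (fun w => (ρ.density ψ w : ℂ)) = ⇑Complex.ofRealCLM ∘ ρ.density ψ := rfl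
      rw [h2, h1]
      rfl
    rw [← re_conj_mul_eq_of_isotropic (hz hzΩ) (im_conj_mul_flux _ p q z)]
    simp only [hη.dx_clm_comp, hη.dy_clm_comp]
    simp only [hfd, Complex.reCLM_apply, Complex.add_re, Complex.re_ofReal_mul,
      ContinuousLinearEquiv.coe_coe, Complex.conjCLE_apply]
    ring
  · simp only [hη.dx_clm_comp, hη.dy_clm_comp]
    simp [image_eq_zero_of_notMem_tsupport hzη,
      dx_of_notMem_tsupport hzη, dy_of_notMem_tsupport hzη]

/-- The pointwise identity behind the first variation in the coordinate `h`, with `u = G'(h)` and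
`v = G''(h)`. -/
lemma re_variation_eq (u v η a b : ℂ) {p q P Q : ℂ} (h : (conj p * P + conj q * Q).im = 0) :
    2 * (conj u * (v * η)).re * (conj p * P + conj q * Q).re +
        (u * conj u).re * (2 * (conj a * P + conj b * Q).re) =
      2 * (conj u * (conj a * (u * P) + conj b * (u * Q)) +
        conj η * (conj (v * p) * (u * P) + conj (v * q) * (u * Q))).re := by
  have e : conj u * (conj a * (u * P) + conj b * (u * Q)) +
      conj η * (conj (v * p) * (u * P) + conj (v * q) * (u * Q)) =
      (u * conj u) * (conj a * P + conj b * Q) +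
        conj (conj u * (v * η)) * (conj p * P + conj q * Q) := by
    simp only [map_mul, Complex.conj_conj]
    ring
  have h1 : (u * conj u).im = 0 := by rw [Complex.mul_conj, Complex.ofReal_im]
  have h2 : ((u * conj u) * (conj a * P + conj b * Q) +
      conj (conj u * (v * η)) * (conj p * P + conj q * Q)).re =
      (u * conj u).re * (conj a * P + conj b * Q).re +
        (conj u * (v * η)).re * (conj p * P + conj q * Q).re := by
    rw [Complex.add_re, Complex.mul_re (u * conj u), Complex.mul_re (conj (conj u * (v * η))),
      h, h1, Complex.conj_re]
    ring
  rw [e, h2]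
  ring

lemma refl_mem_charts : OpenPartialHomeomorph.refl ℂ ∈ Charts ℂ :=
  StructureGroupoid.id_mem_maximalAtlas _

/-- With `G = ψ⁻¹` and `f = G ∘ h`, the first variation of the energy in the coordinate `h` is
`2 Re ∫ A ∇f · ∇(conj (G'(h) η))`, that is, the variation of `f` is `G'(h) η`. -/
theorem SolvesGenLaplaceIn.isHarmonic_flatMetric (σ : ConformalMetric S)
    {μ : BeltramiDifferential S} {f : S → ℂ}
    (hf : SolvesGenLaplaceIn μ f (OpenPartialHomeomorph.refl ℂ)) (hc : Continuous f) :
    IsHarmonic σ μ flatMetric f := by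
  intro φ hφ ψ hψ
  obtain ⟨p, q, hg', hd'⟩ := hf φ hφ
  have hs : locDomain f φ ψ ⊆ locDomain f φ (OpenPartialHomeomorph.refl ℂ) :=
    fun z hz => ⟨hz.1, trivial⟩
  have hg := hg'.mono hs
  have hd := hd'.mono hs
  set F : ℂ → ℂ := loc f φ (OpenPartialHomeomorph.refl ℂ) with hF
  have hΩ := isOpen_locDomain hc φ ψ
  have hFc : ContinuousOn F (locDomain f φ ψ) := (continuousOn_loc hc φ _).mono hs
  have hFψ : Set.MapsTo F (locDomain f φ ψ) ψ.source := fun z hz => hz.2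
  have hψd : DifferentiableOn ℂ ψ ψ.source := fun w hw =>
    (differentiableAt_chart hψ hw).differentiableWithinAt
  have hGd : DifferentiableOn ℂ ψ.symm ψ.target := fun w hw =>
    (differentiableAt_symm hψ hw).differentiableWithinAt
  have hG'd : DifferentiableOn ℂ (deriv ψ.symm) ψ.target := hGd.deriv ψ.open_target
  have hh : HasWeakGradient (locDomain f φ ψ) (loc f φ ψ) (fun z => fderiv ℝ ψ (F z) (p z))
      fun z => fderiv ℝ ψ (F z) (q z) :=
    hg.comp hΩ hFc ψ.open_source (hψd.contDiffOn_real ψ.open_source) hFψ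
  set p' : ℂ → ℂ := fun z => fderiv ℝ ψ (F z) (p z) with hp'
  set q' : ℂ → ℂ := fun z => fderiv ℝ ψ (F z) (q z) with hq'
  refine ⟨p', q', hh, fun K hK hKΩ η hη hηK => ?_⟩
  refine (hasDerivAt_energy σ μ flatMetric hc hφ hψ hh.memLp_x hh.memLp_y hK hKΩ hη
    hηK).congr_deriv ?_
  obtain ⟨hm, k, hk, hmk⟩ := μ.exists_bound hφ (locDomain_subset_target (h := f) (ψ := ψ))
  have hPQ := (weakDivFree_iff_isDivFree (memL2Loc_fluxX hm hk hmk hg.memLp_x hg.memLp_y)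
    (memL2Loc_fluxY hm hk hmk hg.memLp_x hg.memLp_y)).1 hd
  have hΦ : ContDiffOn ℝ ∞ (fun w => conj (deriv ψ.symm w)) ψ.target :=
    (Complex.conjCLE : ℂ →L[ℝ] ℂ).contDiff.comp_contDiffOn (hG'd.contDiffOn_real ψ.open_target)
  have hη' : IsTest (locDomain f φ ψ) fun z => (Complex.conjCLE : ℂ →L[ℝ] ℂ) (η z) :=
    hη.clm_comp _
  have h0 := hPQ.integral_comp_mul_eq_zero hΩ (continuousOn_loc hc φ ψ) hh ψ.open_target hΦ
    mapsTo_loc hη'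
  have hi := hPQ.integrable_comp_mul (continuousOn_loc hc φ ψ) hh ψ.open_target hΦ
    mapsTo_loc hη'
  have hre := Complex.reCLM.integral_comp_comm hi
  rw [h0, map_zero] at hre
  rw [← mul_zero (2 : ℝ), ← hre, ← integral_const_mul]
  congr 1 with z
  by_cases hzη : z ∈ tsupport η
  · have hzΩ := hη.support hzη
    set w := loc f φ ψ z with hw
    have hwt : w ∈ ψ.target := mapsTo_loc hzΩ
    have hGw : DifferentiableAt ℂ (deriv ψ.symm) w :=
      hG'd.differentiableAt (ψ.open_target.mem_nhds hwt)
    have hGr : HasFDerivAt (deriv ψ.symm) (fderiv ℝ (deriv ψ.symm) w) w :=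
      (hGw.restrictScalars ℝ).hasFDerivAt
    have hΦd : ∀ v, fderiv ℝ (fun w => conj (deriv ψ.symm w)) w v =
        conj (deriv (deriv ψ.symm) w * v) := fun v => by
      have h1 := ((Complex.conjCLE : ℂ →L[ℝ] ℂ).hasFDerivAt.comp w hGr).fderiv
      have h2 : (fun w => conj (deriv ψ.symm w)) =
        ⇑(Complex.conjCLE : ℂ →L[ℝ] ℂ) ∘ deriv ψ.symm := rfl
      rw [h2, h1, ← hGw.fderiv_real_apply]
      rfl
    have hrd : fderiv ℝ (flatMetric.density ψ) w (η z) =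
        2 * (conj (deriv ψ.symm w) * (deriv (deriv ψ.symm) w * η z)).re := by
      have h1 := hGr.norm_sq.fderiv
      have h2 : flatMetric.density ψ = fun w => ‖deriv ψ.symm w‖ ^ 2 := rfl
      rw [h2, h1, ← hGw.fderiv_real_apply]
      simp [Complex.inner, mul_comm]
      ring
    have hr : flatMetric.density ψ w = (deriv ψ.symm w * conj (deriv ψ.symm w)).re := by
      rw [Complex.mul_conj, Complex.ofReal_re, Complex.normSq_eq_norm_sq]
      rfl
    -- `G'(h) ψ'(f) = 1`, so that `∇f = G'(h) ∇h`.
    have hinv : deriv ψ.symm w * deriv ψ (F z) = 1 := by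
      have h1 : HasDerivAt (ψ.symm ∘ ψ) (deriv ψ.symm w * deriv ψ (F z)) (F z) :=
        (differentiableAt_symm hψ hwt).hasDerivAt.comp (F z)
          (differentiableAt_chart hψ hzΩ.2).hasDerivAt
      have h2 : HasDerivAt (ψ.symm ∘ ψ) 1 (F z) := by
        refine (hasDerivAt_id (F z)).congr_of_eventuallyEq ?_
        filter_upwards [ψ.open_source.mem_nhds (hFψ hzΩ)] with v hv using ψ.left_inv hv
      exact h1.unique h2
    have hψF : DifferentiableAt ℂ ψ (F z) := differentiableAt_chart hψ hzΩ.2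
    have hPz : fluxX (μ.coeff φ) p q z = deriv ψ.symm w * fluxX (μ.coeff φ) p' q' z := by
      simp only [fluxX, hp', hq', hψF.fderiv_real_apply]
      linear_combination (-((coeffMatrix (μ.coeff φ z) 0 0 : ℂ) * p z +
        (coeffMatrix (μ.coeff φ z) 0 1 : ℂ) * q z)) * hinv
    have hQz : fluxY (μ.coeff φ) p q z = deriv ψ.symm w * fluxY (μ.coeff φ) p' q' z := by
      simp only [fluxY, hp', hq', hψF.fderiv_real_apply]
      linear_combination (-((coeffMatrix (μ.coeff φ z) 1 0 : ℂ) * p z +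
        (coeffMatrix (μ.coeff φ z) 1 1 : ℂ) * q z)) * hinv
    rw [hrd, hr, re_variation_eq _ _ _ _ _ (im_conj_mul_flux _ p' q' z)]
    simp only [hη.dx_clm_comp, hη.dy_clm_comp]
    simp only [hΦd, hPz, hQz, Complex.reCLM_apply, ContinuousLinearEquiv.coe_coe,
      Complex.conjCLE_apply]
  · simp only [hη.dx_clm_comp, hη.dy_clm_comp]
    simp [image_eq_zero_of_notMem_tsupport hzη,
      dx_of_notMem_tsupport hzη, dy_of_notMem_tsupport hzη]

theorem isHarmonic_flatMetric_iff (σ : ConformalMetric S) {μ : BeltramiDifferential S}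
    {f : S → ℂ} (hc : Continuous f) :
    IsHarmonic σ μ flatMetric f ↔ SolvesGenLaplaceIn μ f (OpenPartialHomeomorph.refl ℂ) := by
  refine ⟨fun hf φ hφ => ?_, fun hf => hf.isHarmonic_flatMetric σ hc⟩
  obtain ⟨p, q, hg, hH⟩ := hf φ hφ _ refl_mem_charts
  refine ⟨p, q, hg, ?_⟩
  obtain ⟨hm, k, hk, hmk⟩ := μ.exists_bound hφ
    (locDomain_subset_target (h := f) (ψ := OpenPartialHomeomorph.refl ℂ))
  have hP := memL2Loc_fluxX hm hk hmk hg.memLp_x hg.memLp_y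
  have hQ := memL2Loc_fluxY hm hk hmk hg.memLp_x hg.memLp_y
  rw [weakDivFree_iff_real hP hQ]
  intro η hη
  have hden : flatMetric.density (OpenPartialHomeomorph.refl ℂ) = fun _ => 1 := by
    ext z
    simp [flatMetric]
  have hvar : ∀ ξ : ℂ → ℂ, IsTest (locDomain f φ (OpenPartialHomeomorph.refl ℂ)) ξ →
      ∫ z, 2 * (conj (dx ξ z) * fluxX (μ.coeff φ) p q z +
          conj (dy ξ z) * fluxY (μ.coeff φ) p q z).re = 0 := by
    intro ξ hξ
    have h1 := hH _ hξ.isCompact hξ.support ξ hξ le_rfl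
    have h2 := hasDerivAt_energy σ μ flatMetric hc hφ refl_mem_charts hg.memLp_x hg.memLp_y
      hξ.isCompact hξ.support hξ le_rfl
    have h3 := h2.unique h1
    simpa [hden] using h3
  have hηc := hη.clm_comp Complex.ofRealCLM
  have hi : Integrable fun z => dx η z • fluxX (μ.coeff φ) p q z +
      dy η z • fluxY (μ.coeff φ) p q z := by
    have i1 := (hηc.dx.integrable_mul hP).add (hηc.dy.integrable_mul hQ)
    refine i1.congr (Eventually.of_forall fun z => ?_)
    simp only [Pi.add_apply, hη.dx_clm_comp, hη.dy_clm_comp]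
    simp
  have hre := Complex.reCLM.integral_comp_comm hi
  have him := Complex.imCLM.integral_comp_comm hi
  simp only [Complex.reCLM_apply, Complex.imCLM_apply] at hre him
  have v1 := hvar _ (hη.clm_comp Complex.ofRealCLM)
  have v2 := hvar _ (hη.clm_comp (Complex.ofRealCLM.smulRight Complex.I))
  rw [integral_const_mul] at v1 v2
  simp only [hη.dx_clm_comp, hη.dy_clm_comp] at v1 v2
  apply Complex.ext
  · rw [← hre]
    simpa using v1
  · rw [← him]
    simpa using v2

end Harmonic

end QCHarmonic

end

theorem mainTheorem1
    {S₁ : Type*} [TopologicalSpace S₁] [ChartedSpace ℂ S₁] [IsManifold 𝓘(ℂ) ω S₁]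
    {S₂ : Type*} [TopologicalSpace S₂] [ChartedSpace ℂ S₂] [IsManifold 𝓘(ℂ) ω S₂]
    (σ : QCHarmonic.ConformalMetric S₁) (ρ : QCHarmonic.ConformalMetric S₂)
    (μ : QCHarmonic.BeltramiDifferential S₁) :
    (∀ h : S₁ → S₂, Continuous h →
      (QCHarmonic.SolvesBeltrami μ h ↔
        QCHarmonic.SolvesGenLaplace μ h ∧ QCHarmonic.JacobianNonneg h) ∧
      (QCHarmonic.SolvesGenLaplace μ h → QCHarmonic.IsHarmonic σ μ ρ h) ∧
      (QCHarmonic.SolvesLaplace σ μ h ↔ QCHarmonic.SolvesGenLaplace μ h)) ∧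
    (∀ f : S₁ → ℂ, Continuous f →
      (QCHarmonic.SolvesLaplaceIn σ μ f (OpenPartialHomeomorph.refl ℂ) ↔
        QCHarmonic.SolvesGenLaplaceIn μ f (OpenPartialHomeomorph.refl ℂ)) ∧
      (QCHarmonic.IsHarmonic σ μ QCHarmonic.flatMetric f ↔
        QCHarmonic.SolvesGenLaplaceIn μ f (OpenPartialHomeomorph.refl ℂ))) := by
  refine ⟨fun h hc => ⟨QCHarmonic.solvesBeltrami_iff hc, fun hh => hh.isHarmonic σ ρ hc,
    forall₂_congr fun ψ _ => QCHarmonic.solvesLaplaceIn_iff σ μ hc ψ⟩,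
    fun f hc => ⟨QCHarmonic.solvesLaplaceIn_iff σ μ hc _,
      QCHarmonic.isHarmonic_flatMetric_iff σ hc⟩⟩
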